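/- **Setting.** Let $\mathfrak g$ be a finite-dimensional complex semisimple Lie algebra with a nonsingular symmetric invariant bilinear form $(\cdot,\cdot)$, and let $\mathfrak r\subseteq\mathfrak g$ be a reductive Lie subalgebra on which the form is nonsingular. Let $\mathfrak p=\mathfrak r^\perp$, so $\mathfrak g=\mathfrak r\oplus\mathfrak p$. Let $C(\mathfrak p)$ be the Clifford algebra with $yz+zy=2(y,z)$, with $\wedge\mathfrak p$ identified with $C(\mathfrak p)$ as usual. Let $\mathfrak h$ be a Cartan subalgebra of $\mathfrak g$ containing a Cartan subalgebra $\mathfrak h_{\mathfrak r}=\mathfrak h\cap\mathfrak r$ of $\mathfrak r$, and put $\mathfrak h_{\mathfrak p}=\mathfrak h\cap\mathfrak p$. Let $\mathfrak h^\#\subseteq\mathfrak h$ be the real subspace on which all roots are real and $\kappa:\mathfrak h\to\mathfrak h^\#$ the real projection with kernel $i\mathfrak h^\#$. Choose $f_{\mathfrak r}\in\kappa(\mathfrak h_{\mathfrak r})$ whose centralizer in $\mathfrak g$ equals that of $\mathfrak h_{\mathfrak r}$, and $f\in\mathfrak h^\#$ in the interior of a closed Weyl chamber containing $f_{\mathfrak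 r}$. The positive roots are those positive on $f$; let $\mathfrak n$ be the sum of their root spaces, $\rho\in\mathfrak h^*$ half their sum, $\mathfrak n_{\mathfrak r}=\mathfrak n\cap\mathfrak r$, $\mathfrak n_{\mathfrak p}=\mathfrak n\cap\mathfrak p$, and let $\mathfrak p^+$ be the intersection of $\mathfrak p$ with the sum of the root spaces of the roots that are positive on $f_{\mathfrak r}$. For $x\in\mathfrak h_{\mathfrak r}$ put $\rho_{\mathfrak r}(x)=\frac12\operatorname{tr}(\operatorname{ad}x|\mathfrak n_{\mathfrak r})$ and $\rho_{\mathfrak p}(x)=\frac12\operatorname{tr}(\operatorname{ad}x|\mathfrak p^+)$. Let $\square=\sum_i b_i\otimes d_i+1\otimes v\in U(\mathfrak g)\otimes C(\mathfrak p)$ be the cubic Dirac operator, where $(b_i)$, $(d_i)$ are dual bases of $\mathfrak p$ and $v\in\wedge^3\mathfrak p$ is defined by $([x,y],z)=-2(v,x\wedge y\wedge z)$ for $x,y,z\in\mathfrak p$. Let $\nu_*:\mathfrak r\to\wedge^2\mathfrak p\subseteq C(\mathfrak p)$ be the Lie algebra homomorphism with $[\nu_*(x),y]=[x,y]$ for $y\in\mathfrak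 p$, and $\zeta:U(\mathfrak r)\to U(\mathfrak g)\otimes C(\mathfrak p)$ the algebra homomorphism with $\zeta(x)=x\otimes1+1\otimes\nu_*(x)$ for $x\in\mathfrak r$. Let $u\in C(\mathfrak p)$ be the product of the elements of a basis of $\mathfrak n_{\mathfrak p}$ and $L=C(\mathfrak p)u$. For $\lambda\in\mathfrak h^*$ let $V_\lambda$ be the irreducible $\mathfrak g$-module of highest weight $\lambda$ with respect to $\mathfrak b=\mathfrak h+\mathfrak n$, with highest weight vector $v_\lambda$. Let $\square_\lambda$ be the action of $\square$ on $V_\lambda\otimes L$ and $$H_D(V_\lambda\otimes L)=\operatorname{Ker}\square_\lambda/(\operatorname{Ker}\square_\lambda\cap\operatorname{Im}\square_\lambda).$$ Let $Z(\mathfrak g)$, $Z(\mathfrak r)$ be the centers of $U(\mathfrak g)$, $U(\mathfrak r)$; $Z(\mathfrak g)\otimes 1$ and $\zeta(Z(\mathfrak r))$ commute with $\square$, hence act on $H_D(V_\lambda\otimes L)$. Let $A_{\mathfrak g}:Z(\mathfrak g)\to S(\mathfrak h)$ and $A_{\mathfrak r}:Z(\mathfrak r)\to S(\mathfrak h_{\mathfrak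 r})$ be the Harish-Chandra homomorphisms: $A_{\mathfrak g}(p)(\mu)=p_0(\mu-\rho)$ for $\mu\in\mathfrak h^*$, where $p_0\in S(\mathfrak h)$ is defined by $p-p_0\in U(\mathfrak g)\mathfrak n$, and $A_{\mathfrak r}(q)(\mu)=q_0(\mu-\rho_{\mathfrak r})$ for $\mu\in\mathfrak h_{\mathfrak r}^*$, where $q_0\in S(\mathfrak h_{\mathfrak r})$ is defined by $q-q_0\in U(\mathfrak r)\mathfrak n_{\mathfrak r}$. **Theorem 4.1.** Let $\lambda\in\mathfrak h^*$ satisfy $(\lambda+\rho)|_{\mathfrak h_{\mathfrak p}}=0$. Let $C(\mathfrak h_{\mathfrak p})\subseteq C(\mathfrak p)$ be the subalgebra generated by $\mathfrak h_{\mathfrak p}$. Then $\mathbb C v_\lambda\otimes C(\mathfrak h_{\mathfrak p})u\subseteq\operatorname{Ker}\square_\lambda$; let $E_{\lambda,L}$ be its image in $H_D(V_\lambda\otimes L)$. For all $p\in Z(\mathfrak g)$ and $q\in Z(\mathfrak r)$, $p\otimes1$ acts on $E_{\lambda,L}$ as the scalar $A_{\mathfrak g}(p)(\lambda+\rho)$,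 and $\zeta(q)$ acts on $E_{\lambda,L}$ as the scalar $A_{\mathfrak r}(q)\bigl((\lambda+\rho)|_{\mathfrak h_{\mathfrak r}}\bigr)$. Moreover $\rho_{\mathfrak p}+\rho_{\mathfrak r}=\rho|_{\mathfrak h_{\mathfrak r}}$. -/

import Mathlib

open scoped TensorProduct

set_option linter.unusedSectionVars false

attribute [local instance 100] LieRing.ofAssociativeRing

noncomputable section

namespace CubicDirac

/-! ### Cohomology of an endomorphism -/

section Cohomology

variable {M : Type*} [AddCommGroup M] [Module ℂ M]

/-- `Ker d / (Ker d ∩ Im d)` for an endomorphism `d` (it is not required that `d² = 0`). -/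
abbrev Cohomology (d : Module.End ℂ M) : Type _ :=
  LinearMap.ker d ⧸ (LinearMap.range d).submoduleOf (LinearMap.ker d)

/-- The class of an element of the kernel. -/
abbrev cohomologyClass (d : Module.End ℂ M) : LinearMap.ker d →ₗ[ℂ] Cohomology d :=
  ((LinearMap.range d).submoduleOf (LinearMap.ker d)).mkQ

theorem commute_apply {d : Module.End ℂ M} (s : Subalgebra.centralizer ℂ {d}) (x : M) :
    d (s.1 x) = s.1 (d x) := by
  have h := (Subalgebra.mem_centralizer_iff ℂ).1 s.2 d (Set.mem_singleton d)
  exact LinearMap.congr_fun h x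

/-- An endomorphism commuting with `d` preserves `Ker d`. -/
def kerRestrict (d : Module.End ℂ M) (s : Subalgebra.centralizer ℂ {d}) :
    LinearMap.ker d →ₗ[ℂ] LinearMap.ker d :=
  s.1.restrict fun x hx => by
    rw [LinearMap.mem_ker] at hx ⊢
    rw [commute_apply, hx, map_zero]

/-- The action of the endomorphisms commuting with `d` on the cohomology of `d`. -/
def cohomologyAction (d : Module.End ℂ M) :
    Subalgebra.centralizer ℂ {d} →ₐ[ℂ] Module.End ℂ (Cohomology d) :=
  AlgHom.ofLinearMap
    { toFun := fun s => Submodule.mapQ _ _ (kerRestrict d s) (by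
        rintro ⟨x, hx⟩ ⟨y, hy⟩
        exact ⟨s.1 y, by rw [commute_apply, hy]; rfl⟩)
      map_add' := fun s t => by
        ext x
        rfl
      map_smul' := fun c s => by
        ext x
        rfl }
    (by ext x; rfl)
    (fun s t => by ext x; rfl)

end Cohomology

/-! ### Highest weight modules and the Harish-Chandra homomorphism -/

section HighestWeight

variable {𝔞 : Type*} [LieRing 𝔞] [LieAlgebra ℂ 𝔞]

local notation "U" => UniversalEnvelopingAlgebra ℂ
local notation "Z" 𝔞:max => Subalgebra.center ℂ (UniversalEnvelopingAlgebra ℂ 𝔞)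

/-- For a subspace `𝔫`, the left ideal `U(𝔞) 𝔫` of `U(𝔞)`. -/
def leftIdeal (𝔫 : Submodule ℂ 𝔞) : Submodule (U 𝔞) (U 𝔞) :=
  Submodule.span (U 𝔞) (UniversalEnvelopingAlgebra.ι ℂ '' (𝔫 : Set 𝔞))

/-- The left ideal of `U(𝔞)` generated by `𝔫` and by the elements `x - μ(x)`, `x ∈ 𝔱`. -/
def vermaIdeal (𝔱 : LieSubalgebra ℂ 𝔞) (𝔫 : Submodule ℂ 𝔞) (μ : Module.Dual ℂ 𝔱) :
    Submodule (U 𝔞) (U 𝔞) :=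
  leftIdeal 𝔫 ⊔ Submodule.span (U 𝔞) (Set.range fun x : 𝔱 =>
    UniversalEnvelopingAlgebra.ι ℂ (x : 𝔞) - algebraMap ℂ (U 𝔞) (μ x))

/-- The Verma module `U(𝔞) ⊗_{U(𝔟)} ℂ_μ`, `𝔟 = 𝔱 + 𝔫`, as the quotient of `U(𝔞)` by the left ideal
generated by the `x - μ(x)` for `x ∈ 𝔟`, where `μ` is extended to `𝔟` by `0` on `𝔫`. -/
abbrev Verma (𝔱 : LieSubalgebra ℂ 𝔞) (𝔫 : Submodule ℂ 𝔞) (μ : Module.Dual ℂ 𝔱) : Type _ :=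
  U 𝔞 ⧸ vermaIdeal 𝔱 𝔫 μ

/-- The largest proper submodule of the Verma module: the sum of all proper submodules. -/
def vermaRadical (𝔱 : LieSubalgebra ℂ 𝔞) (𝔫 : Submodule ℂ 𝔞) (μ : Module.Dual ℂ 𝔱) :
    Submodule (U 𝔞) (Verma 𝔱 𝔫 μ) :=
  sSup {N | N ≠ ⊤}

/-- The irreducible module `V_μ` of highest weight `μ`. -/
abbrev SimpleHW (𝔱 : LieSubalgebra ℂ 𝔞) (𝔫 : Submodule ℂ 𝔞) (μ : Module.Dual ℂ 𝔱) : Type _ :=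
  Verma 𝔱 𝔫 μ ⧸ vermaRadical 𝔱 𝔫 μ

/-- The canonical highest weight vector of `V_μ`. -/
def hwVector (𝔱 : LieSubalgebra ℂ 𝔞) (𝔫 : Submodule ℂ 𝔞) (μ : Module.Dual ℂ 𝔱) :
    SimpleHW 𝔱 𝔫 μ :=
  Submodule.Quotient.mk (Submodule.Quotient.mk 1)

/-- `z ≡ s` modulo `U(𝔞) 𝔫`, where `s ∈ S(𝔱)`, for a commutative subalgebra `𝔱`: then the algebra
homomorphism `T(𝔱) → U(𝔞)` factors through `S(𝔱) = U(𝔱)`, so it does not matter which lift `w` of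
`s` to the tensor algebra is used. -/
def CongruentModN (𝔱 : LieSubalgebra ℂ 𝔞) (𝔫 : Submodule ℂ 𝔞) (z : U 𝔞)
    (s : SymmetricAlgebra ℂ 𝔱) : Prop :=
  ∃ w : TensorAlgebra ℂ 𝔱, SymmetricAlgebra.algHom ℂ 𝔱 w = s ∧
    z - TensorAlgebra.lift ℂ
      ((UniversalEnvelopingAlgebra.ι ℂ : 𝔞 →ₗ⁅ℂ⁆ U 𝔞).toLinearMap ∘ₗ 𝔱.toSubmodule.subtype) w
      ∈ leftIdeal 𝔫

/-- The projection `Z(𝔞) → S(𝔱)` along `U(𝔞) 𝔫`, for a reductive `𝔞` with Cartan subalgebra `𝔱` and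
Borel subalgebra `𝔱 + 𝔫`: one has `Z(𝔞) ⊆ S(𝔱) ⊕ U(𝔞) 𝔫`, so there is exactly one `s ∈ S(𝔱)`
congruent to `z`. -/
def hcProjection (𝔱 : LieSubalgebra ℂ 𝔞) (𝔫 : Submodule ℂ 𝔞) (z : Z 𝔞) : SymmetricAlgebra ℂ 𝔱 :=
  Classical.epsilon fun s => CongruentModN 𝔱 𝔫 (z : U 𝔞) s

/-- The value at `μ ∈ 𝔱*` of an element of `S(𝔱)`, regarded as a polynomial function on `𝔱*`. -/
def evalSym {𝔱 : LieSubalgebra ℂ 𝔞} (s : SymmetricAlgebra ℂ 𝔱) (μ : Module.Dual ℂ 𝔱) : ℂ :=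
  SymmetricAlgebra.lift μ s

/-- The automorphism `x ↦ x - ρ(x)` (`x ∈ 𝔱`) of `S(𝔱)`. -/
def shift {𝔱 : LieSubalgebra ℂ 𝔞} (ρ : Module.Dual ℂ 𝔱) :
    SymmetricAlgebra ℂ 𝔱 →ₐ[ℂ] SymmetricAlgebra ℂ 𝔱 :=
  SymmetricAlgebra.lift (SymmetricAlgebra.ι ℂ 𝔱 - (Algebra.linearMap ℂ _) ∘ₗ ρ)

/-- The Harish-Chandra homomorphism `A : Z(𝔞) → S(𝔱)`: the projection along `U(𝔞) 𝔫`, followed by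
the `ρ`-shift. -/
def harishChandra (𝔱 : LieSubalgebra ℂ 𝔞) (𝔫 : Submodule ℂ 𝔞) (ρ : Module.Dual ℂ 𝔱) (z : Z 𝔞) :
    SymmetricAlgebra ℂ 𝔱 :=
  shift ρ (hcProjection 𝔱 𝔫 z)

end HighestWeight

/-! ### The pair `(𝔤, 𝔯)` and the cubic Dirac operator -/

/-- A nonsingular symmetric invariant form on `𝔤` together with a reductive subalgebra `𝔯` on which
it is nonsingular. -/
structure QuadraticPair (𝔤 : Type*) [LieRing 𝔤] [LieAlgebra ℂ 𝔤] where
  form : LinearMap.BilinForm ℂ 𝔤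
  form_symm : form.IsSymm
  form_nondeg : form.Nondegenerate
  form_inv : form.lieInvariant 𝔤
  r : LieSubalgebra ℂ 𝔤
  reductive : LieAlgebra.HasCentralRadical ℂ r
  form_r_nondeg : (form.restrict r.toSubmodule).Nondegenerate

namespace QuadraticPair

variable {𝔤 : Type*} [LieRing 𝔤] [LieAlgebra ℂ 𝔤] [FiniteDimensional ℂ 𝔤] (D : QuadraticPair 𝔤)

/-- The orthocomplement `𝔭` of `𝔯` in `𝔤`, with its `𝔯`-module structure. -/
def p : LieSubmodule ℂ D.r 𝔤 where
  __ := D.form.orthogonal D.r.toSubmodule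
  lie_mem := by
    intro x m hm n hn
    have h := D.form_inv (x : 𝔤) n m
    have h2 := hm ⁅(x : 𝔤), n⁆ (D.r.lie_mem x.2 hn)
    change D.form n ⁅(x : 𝔤), m⁆ = 0
    change D.form ⁅(x : 𝔤), n⁆ m = 0 at h2
    rw [h2] at h
    exact neg_eq_zero.1 h.symm

/-- The restriction of the form to `𝔭`. -/
def formP : LinearMap.BilinForm ℂ D.p := D.form.restrict D.p.toSubmodule

theorem formP_nondeg : D.formP.Nondegenerate := by
  have hr : D.form.IsRefl := D.form_symm.isRefl
  have h1 := (LinearMap.BilinForm.restrict_nondegenerate_iff_isCompl_orthogonal hr).1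
    D.form_r_nondeg
  have h2 : IsCompl (D.form.orthogonal D.r.toSubmodule)
      (D.form.orthogonal (D.form.orthogonal D.r.toSubmodule)) := by
    rw [LinearMap.BilinForm.orthogonal_orthogonal D.form_nondeg hr]
    exact h1.symm
  exact (LinearMap.BilinForm.restrict_nondegenerate_iff_isCompl_orthogonal hr).2 h2

theorem formP_symm (a b : D.p) : D.formP a b = D.formP b a := D.form_symm.eq _ _

theorem formP_inv (x : D.r) (a b : D.p) : D.formP ⁅x, a⁆ b = - D.formP a ⁅x, b⁆ :=
  D.form_inv (x : 𝔤) (a : 𝔤) (b : 𝔤)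

/-- The quadratic form `y ↦ (y, y)` on `𝔭`. -/
def quad : QuadraticForm ℂ D.p := D.formP.toQuadraticMap

/-- The Clifford algebra `C(𝔭)`, in which `y² = (y, y)`, i.e. `y z + z y = 2 (y, z)`. -/
abbrev Cl : Type _ := CliffordAlgebra D.quad

/-- The inclusion of `𝔭` into `C(𝔭)`. -/
abbrev γ : D.p →ₗ[ℂ] D.Cl := CliffordAlgebra.ι D.quad

/-- The identification of `⋀ 𝔭` with `C(𝔭)`. -/
def quantize : ExteriorAlgebra ℂ D.p →ₗ[ℂ] D.Cl :=
  (CliffordAlgebra.equivExterior D.quad).symm.toLinearMap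

/-- The index set of the basis of `𝔭` used below. -/
abbrev I : Type := Fin (Module.finrank ℂ D.p)

/-- A basis of `𝔭`; the objects defined with it and its dual basis do not depend on it. -/
def b : Module.Basis D.I ℂ D.p := Module.finBasis ℂ D.p

/-- The dual basis with respect to the form: `(d i, b j) = δ_{ij}`. -/
def d : Module.Basis D.I ℂ D.p := D.formP.dualBasis D.formP_nondeg D.b

/-- The element `x ∧ y` of `⋀² 𝔭 ⊆ C(𝔭)`. -/
def wedge2 (x y : D.p) : D.Cl :=
  D.quantize (ExteriorAlgebra.ι ℂ x * ExteriorAlgebra.ι ℂ y)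

/-- The element `x ∧ y ∧ z` of `⋀³ 𝔭 ⊆ C(𝔭)`. -/
def wedge3 (x y z : D.p) : D.Cl :=
  D.quantize (ExteriorAlgebra.ι ℂ x * (ExteriorAlgebra.ι ℂ y * ExteriorAlgebra.ι ℂ z))

/-- The trilinear form `([x, y], z)` on `𝔭`. -/
def tri (x y z : D.p) : ℂ := D.form ⁅(x : 𝔤), (y : 𝔤)⁆ (z : 𝔤)

/-- The cubic element `v ∈ ⋀³ 𝔭`, determined by `([x, y], z) = -2 (v, x ∧ y ∧ z)`. In terms of
dual bases, `v = -1/2 ∑_{i<j<k} ([b i, b j], b k) d i ∧ d j ∧ d k`. -/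
def cubic : D.Cl :=
  (-1 / 12 : ℂ) • ∑ i, ∑ j, ∑ k, D.tri (D.b i) (D.b j) (D.b k) • D.wedge3 (D.d i) (D.d j) (D.d k)

/-- The algebra `U(𝔤) ⊗ C(𝔭)`. -/
abbrev UC : Type _ := UniversalEnvelopingAlgebra ℂ 𝔤 ⊗[ℂ] D.Cl

/-- The cubic Dirac operator `□ = ∑ b i ⊗ d i + 1 ⊗ v`. -/
def dirac : D.UC :=
  (∑ i, UniversalEnvelopingAlgebra.ι ℂ (D.b i : 𝔤) ⊗ₜ[ℂ] D.γ (D.d i)) + 1 ⊗ₜ[ℂ] D.cubic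

/-- The map `ν_* : 𝔯 → ⋀² 𝔭 ⊆ C(𝔭)`, characterised by `[ν_*(x), y] = [x, y]` for `y ∈ 𝔭`. In terms
of dual bases, `ν_*(x) = 1/4 ∑ [x, b i] ∧ d i`. -/
def nu (x : D.r) : D.Cl := (1 / 4 : ℂ) • ∑ i, D.wedge2 ⁅x, D.b i⁆ (D.d i)

theorem d_form_b (i j : D.I) : D.formP (D.d i) (D.b j) = if j = i then 1 else 0 :=
  LinearMap.BilinForm.apply_dualBasis_left D.formP_nondeg D.b i j

theorem b_form_d (i j : D.I) : D.formP (D.b i) (D.d j) = if i = j then 1 else 0 := by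
  rw [formP_symm, d_form_b]

theorem sum_b (y : D.p) : ∑ i, D.formP (D.d i) y • D.b i = y := by
  conv_rhs => rw [← D.b.sum_repr y]
  refine Finset.sum_congr rfl fun i _ => ?_
  congr 1
  conv_lhs => rw [← D.b.sum_repr y]
  simp only [map_sum, map_smul, d_form_b, smul_eq_mul, mul_ite, mul_one, mul_zero,
    Finset.sum_ite_eq', Finset.mem_univ, if_true]

theorem sum_d (y : D.p) : ∑ i, D.formP (D.b i) y • D.d i = y := by
  conv_rhs => rw [← D.d.sum_repr y]
  refine Finset.sum_congr rfl fun i _ => ?_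
  congr 1
  conv_lhs => rw [← D.d.sum_repr y]
  simp only [map_sum, map_smul, b_form_d, smul_eq_mul, mul_ite, mul_one, mul_zero,
    Finset.sum_ite_eq, Finset.mem_univ, if_true]

/-- Invariance of the canonical element `∑ b i ⊗ d i` under `𝔯`. -/
theorem canonical_inv {N : Type*} [AddCommGroup N] [Module ℂ N] (β : D.p →ₗ[ℂ] D.p →ₗ[ℂ] N)
    (x : D.r) : ∑ i, β (D.b i) ⁅x, D.d i⁆ = - ∑ i, β ⁅x, D.b i⁆ (D.d i) := by
  have h1 : ∀ i, β (D.b i) ⁅x, D.d i⁆ =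
      ∑ j, D.formP (D.b j) ⁅x, D.d i⁆ • β (D.b i) (D.d j) := by
    intro i
    conv_lhs => rw [← D.sum_d ⁅x, D.d i⁆]
    simp only [map_sum, map_smul]
  have h2 : ∀ i, β ⁅x, D.b i⁆ (D.d i) =
      ∑ j, D.formP (D.d j) ⁅x, D.b i⁆ • β (D.b j) (D.d i) := by
    intro i
    conv_lhs => rw [← D.sum_b ⁅x, D.b i⁆]
    simp only [map_sum, map_smul, LinearMap.sum_apply, LinearMap.smul_apply]
  simp only [h1, h2]
  rw [Finset.sum_comm (f := fun i j => D.formP (D.d j) ⁅x, D.b i⁆ • β (D.b j) (D.d i)),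
    ← Finset.sum_neg_distrib]
  refine Finset.sum_congr rfl fun i _ => ?_
  rw [← Finset.sum_neg_distrib]
  refine Finset.sum_congr rfl fun j _ => ?_
  rw [← neg_smul]
  congr 1
  rw [← D.formP_inv x, D.formP_symm]

theorem assoc_apply (x y : D.p) :
    QuadraticMap.associated (R := ℂ) D.quad x y = D.formP x y := by
  have h : QuadraticMap.associated (R := ℂ) D.quad = D.formP :=
    QuadraticMap.associated_left_inverse ℂ D.formP_symm
  rw [h]

theorem quantize_proof : LinearMap.BilinMap.toQuadraticMap
    (-QuadraticMap.associated (R := ℂ) (-D.quad)) = D.quad - 0 :=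
  CliffordAlgebra.changeForm.neg_proof CliffordAlgebra.changeForm.associated_neg_proof

theorem wedge2_eq (x y : D.p) :
    D.wedge2 x y = D.γ x * D.γ y - algebraMap ℂ D.Cl (D.formP x y) := by
  change CliffordAlgebra.changeForm D.quantize_proof
    (CliffordAlgebra.ι _ x * CliffordAlgebra.ι _ y) = _
  rw [CliffordAlgebra.changeForm_ι_mul_ι]
  simp [assoc_apply]

theorem wedge3_eq (x y z : D.p) :
    D.wedge3 x y z = D.γ x * (D.γ y * D.γ z) - D.formP y z • D.γ x
      - (D.formP x y • D.γ z - D.formP x z • D.γ y) := by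
  change CliffordAlgebra.changeForm D.quantize_proof
    (CliffordAlgebra.ι _ x * (CliffordAlgebra.ι _ y * CliffordAlgebra.ι _ z)) = _
  rw [CliffordAlgebra.changeForm_ι_mul, CliffordAlgebra.changeForm_ι_mul_ι]
  rw [map_sub, CliffordAlgebra.contractLeft_algebraMap, CliffordAlgebra.contractLeft_ι_mul,
    CliffordAlgebra.contractLeft_ι]
  simp [assoc_apply, mul_sub, Algebra.algebraMap_eq_smul_one]

theorem γ_anticomm (x y : D.p) :
    D.γ x * D.γ y = algebraMap ℂ D.Cl (2 * D.formP x y) - D.γ y * D.γ x := by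
  have h := CliffordAlgebra.ι_mul_ι_add_swap (Q := D.quad) x y
  have h2 : QuadraticMap.polar D.quad x y = 2 * D.formP x y := by
    rw [quad, LinearMap.BilinMap.polar_toQuadraticMap, D.formP_symm y x]
    ring
  rw [h2] at h
  exact eq_sub_of_add_eq h

/-- `[ν_*(x), y] = [x, y]` for `x ∈ 𝔯` and `y ∈ 𝔭`. -/
theorem nu_comm (x : D.r) (y : D.p) : D.nu x * D.γ y - D.γ y * D.nu x = D.γ ⁅x, y⁆ := by
  have key : ∀ p q : D.p, D.wedge2 p q * D.γ y - D.γ y * D.wedge2 p q =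
      (2 : ℂ) • D.γ (D.formP q y • p - D.formP p y • q) := by
    intro p q
    have h1 : D.γ p * D.γ q * D.γ y = D.γ p * (algebraMap ℂ D.Cl (2 * D.formP q y) - D.γ y * D.γ q) := by
      rw [mul_assoc, γ_anticomm D q y]
    have h2 : D.γ y * (D.γ p * D.γ q) = (algebraMap ℂ D.Cl (2 * D.formP p y) - D.γ p * D.γ y) * D.γ q := by
      rw [← mul_assoc, γ_anticomm D y p, D.formP_symm y p]
    rw [wedge2_eq, sub_mul, mul_sub, h1, h2, Algebra.commutes (D.formP p q) (D.γ y)]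
    simp only [Algebra.algebraMap_eq_smul_one, mul_sub, sub_mul, mul_smul_comm, smul_mul_assoc,
      mul_one, one_mul, map_sub, map_smul, smul_sub, smul_smul, mul_assoc]
    abel
  have h3 : D.nu x * D.γ y - D.γ y * D.nu x = (1 / 4 : ℂ) • ∑ i, (2 : ℂ) •
      D.γ (D.formP (D.d i) y • ⁅x, D.b i⁆ - D.formP ⁅x, D.b i⁆ y • D.d i) := by
    simp only [← key, nu]
    rw [smul_mul_assoc, mul_smul_comm, ← smul_sub, Finset.sum_mul, Finset.mul_sum,
      Finset.sum_sub_distrib]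
  rw [h3, ← Finset.smul_sum, ← map_sum, Finset.sum_sub_distrib]
  have h4 : ∑ i, D.formP (D.d i) y • ⁅x, D.b i⁆ = ⁅x, y⁆ := by
    conv_rhs => rw [← D.sum_b y]
    rw [lie_sum]
    simp only [lie_smul]
  have h5 : ∑ i, D.formP ⁅x, D.b i⁆ y • D.d i = - ⁅x, y⁆ := by
    conv_rhs => rw [← D.sum_d ⁅x, y⁆]
    rw [← Finset.sum_neg_distrib]
    simp only [formP_inv, neg_smul]
  rw [h4, h5, sub_neg_eq_add, ← two_smul ℂ, map_smul, smul_smul, smul_smul]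
  norm_num

/-- Commutation with an element of `C(𝔭)`, as a derivation. -/
theorem nu_comm_mul (x : D.r) (w w' : D.Cl) : D.nu x * (w * w') - w * w' * D.nu x =
    (D.nu x * w - w * D.nu x) * w' + w * (D.nu x * w' - w' * D.nu x) := by
  noncomm_ring

theorem nu_comm_wedge2 (x : D.r) (y z : D.p) :
    D.nu x * D.wedge2 y z - D.wedge2 y z * D.nu x = D.wedge2 ⁅x, y⁆ z + D.wedge2 y ⁅x, z⁆ := by
  have h := D.nu_comm_mul x (D.γ y) (D.γ z)
  rw [nu_comm, nu_comm] at h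
  simp only [wedge2_eq, mul_sub, sub_mul]
  rw [← Algebra.commutes (D.formP y z) (D.nu x)]
  rw [formP_inv, map_neg]
  refine sub_eq_zero.1 (Eq.trans ?_ (sub_eq_zero.2 h))
  noncomm_ring

theorem nu_comm_wedge3 (x : D.r) (y z t : D.p) :
    D.nu x * D.wedge3 y z t - D.wedge3 y z t * D.nu x =
      D.wedge3 ⁅x, y⁆ z t + D.wedge3 y ⁅x, z⁆ t + D.wedge3 y z ⁅x, t⁆ := by
  have h := D.nu_comm_mul x (D.γ y) (D.γ z * D.γ t)
  rw [D.nu_comm_mul x (D.γ z) (D.γ t)] at h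
  have h1 := D.nu_comm x y
  have h2 := D.nu_comm x z
  have h3 := D.nu_comm x t
  rw [h1, h2, h3] at h
  simp only [wedge3_eq, formP_inv, ← h1, ← h2, ← h3] at h ⊢
  simp only [mul_sub, sub_mul, mul_add, mul_smul_comm, smul_mul_assoc, smul_sub, neg_smul]
    at h ⊢
  refine sub_eq_zero.1 (Eq.trans ?_ (sub_eq_zero.2 h))
  module

/-- `x ∧ y` as a bilinear map. -/
def wedge2L : D.p →ₗ[ℂ] D.p →ₗ[ℂ] D.Cl :=
  LinearMap.mk₂ ℂ D.wedge2
    (fun a b c => by simp only [wedge2, map_add, add_mul])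
    (fun t a b => by simp only [wedge2, map_smul, smul_mul_assoc])
    (fun a b c => by simp only [wedge2, map_add, mul_add])
    (fun t a b => by simp only [wedge2, map_smul, mul_smul_comm])

theorem nu_eq (x : D.r) : D.nu x = (1 / 4 : ℂ) • ∑ i, D.wedge2L ⁅x, D.b i⁆ (D.d i) := rfl

theorem nu_comm_nu (x y : D.r) : D.nu x * D.nu y - D.nu y * D.nu x = D.nu ⁅x, y⁆ := by
  have h1 : D.nu x * D.nu y - D.nu y * D.nu x = (1 / 4 : ℂ) • ∑ i,
      (D.wedge2 ⁅x, ⁅y, D.b i⁆⁆ (D.d i) + D.wedge2 ⁅y, D.b i⁆ ⁅x, D.d i⁆) := by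
    simp only [← nu_comm_wedge2]
    rw [Finset.sum_sub_distrib, ← Finset.mul_sum, ← Finset.sum_mul, smul_sub, ← mul_smul_comm,
      ← smul_mul_assoc]
    rfl
  have h2 := D.canonical_inv (D.wedge2L ∘ₗ (LieModule.toEnd ℂ D.r D.p y)) x
  have h3 : ∑ i, D.wedge2 ⁅y, D.b i⁆ ⁅x, D.d i⁆ = - ∑ i, D.wedge2 ⁅y, ⁅x, D.b i⁆⁆ (D.d i) := h2
  rw [h1, Finset.sum_add_distrib, h3, ← sub_eq_add_neg, ← Finset.sum_sub_distrib, nu_eq]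
  congr 1
  refine Finset.sum_congr rfl fun i _ => ?_
  rw [lie_lie, map_sub, LinearMap.sub_apply]
  rfl

/-- `ν_*` as a homomorphism of Lie algebras. -/
def nuHom : D.r →ₗ⁅ℂ⁆ D.Cl where
  toFun := D.nu
  map_add' x y := by
    simp only [nu_eq, add_lie, map_add, LinearMap.add_apply, Finset.sum_add_distrib, smul_add]
  map_smul' c x := by
    simp only [nu_eq, smul_lie, map_smul, LinearMap.smul_apply, ← Finset.smul_sum,
      RingHom.id_apply]
    rw [smul_comm]
  map_lie' {x y} := by
    rw [LieRing.of_associative_ring_bracket]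
    exact (D.nu_comm_nu x y).symm

theorem tri_inv (x : D.r) (y z t : D.p) :
    D.tri ⁅x, y⁆ z t + D.tri y ⁅x, z⁆ t + D.tri y z ⁅x, t⁆ = 0 := by
  have h := D.form_inv (x : 𝔤) ⁅(y : 𝔤), (z : 𝔤)⁆ (t : 𝔤)
  have h1 : D.form ⁅(x : 𝔤), ⁅(y : 𝔤), (z : 𝔤)⁆⁆ (t : 𝔤) =
      D.tri ⁅x, y⁆ z t + D.tri y ⁅x, z⁆ t := by
    rw [leibniz_lie, map_add, LinearMap.add_apply]
    rfl
  rw [h1] at h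
  rw [h]
  exact neg_add_cancel _

/-- `v` is invariant under `𝔯`, hence commutes with `ν_*(𝔯)`. -/
theorem nu_comm_cubic (x : D.r) : D.nu x * D.cubic - D.cubic * D.nu x = 0 := by
  have h1 : ∀ j k, ∑ i, D.tri (D.b i) (D.b j) (D.b k) • D.wedge3 ⁅x, D.d i⁆ (D.d j) (D.d k) =
      - ∑ i, D.tri ⁅x, D.b i⁆ (D.b j) (D.b k) • D.wedge3 (D.d i) (D.d j) (D.d k) := by
    intro j k
    exact D.canonical_inv (LinearMap.mk₂ ℂ
      (fun y z => D.tri y (D.b j) (D.b k) • D.wedge3 z (D.d j) (D.d k))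
      (fun a b c => by simp [tri, add_smul]) (fun t a b => by simp [tri, smul_smul])
      (fun a b c => by simp [wedge3, add_mul]) (fun t a b => by simp [wedge3, smul_smul, mul_comm])) x
  have h2 : ∀ i k, ∑ j, D.tri (D.b i) (D.b j) (D.b k) • D.wedge3 (D.d i) ⁅x, D.d j⁆ (D.d k) =
      - ∑ j, D.tri (D.b i) ⁅x, D.b j⁆ (D.b k) • D.wedge3 (D.d i) (D.d j) (D.d k) := by
    intro i k
    exact D.canonical_inv (LinearMap.mk₂ ℂ
      (fun y z => D.tri (D.b i) y (D.b k) • D.wedge3 (D.d i) z (D.d k))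
      (fun a b c => by simp [tri, add_smul]) (fun t a b => by simp [tri, smul_smul])
      (fun a b c => by simp [wedge3, add_mul, mul_add])
      (fun t a b => by simp [wedge3, smul_smul, mul_comm])) x
  have h3 : ∀ i j, ∑ k, D.tri (D.b i) (D.b j) (D.b k) • D.wedge3 (D.d i) (D.d j) ⁅x, D.d k⁆ =
      - ∑ k, D.tri (D.b i) (D.b j) ⁅x, D.b k⁆ • D.wedge3 (D.d i) (D.d j) (D.d k) := by
    intro i j
    exact D.canonical_inv (LinearMap.mk₂ ℂ
      (fun y z => D.tri (D.b i) (D.b j) y • D.wedge3 (D.d i) (D.d j) z)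
      (fun a b c => by simp [tri, add_smul]) (fun t a b => by simp [tri, smul_smul])
      (fun a b c => by simp [wedge3, mul_add])
      (fun t a b => by simp [wedge3, smul_smul, mul_comm])) x
  have rot : ∀ F : D.I → D.I → D.I → D.Cl,
      ∑ i, ∑ j, ∑ k, F i j k = ∑ j, ∑ k, ∑ i, F i j k := fun F =>
    Finset.sum_comm.trans (Finset.sum_congr rfl fun _ _ => Finset.sum_comm)
  have e1 : ∑ i, ∑ j, ∑ k, D.tri (D.b i) (D.b j) (D.b k) • D.wedge3 ⁅x, D.d i⁆ (D.d j) (D.d k) =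
      - ∑ i, ∑ j, ∑ k, D.tri ⁅x, D.b i⁆ (D.b j) (D.b k) • D.wedge3 (D.d i) (D.d j) (D.d k) := by
    refine (rot _).trans (Eq.trans ?_ (congrArg Neg.neg (rot _).symm))
    rw [← Finset.sum_neg_distrib]
    refine Finset.sum_congr rfl fun j _ => ?_
    rw [← Finset.sum_neg_distrib]
    exact Finset.sum_congr rfl fun k _ => h1 j k
  have e2 : ∑ i, ∑ j, ∑ k, D.tri (D.b i) (D.b j) (D.b k) • D.wedge3 (D.d i) ⁅x, D.d j⁆ (D.d k) =
      - ∑ i, ∑ j, ∑ k, D.tri (D.b i) ⁅x, D.b j⁆ (D.b k) • D.wedge3 (D.d i) (D.d j) (D.d k) := by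
    rw [← Finset.sum_neg_distrib]
    refine Finset.sum_congr rfl fun i _ => ?_
    refine Finset.sum_comm.trans (Eq.trans ?_ (congrArg Neg.neg Finset.sum_comm))
    rw [← Finset.sum_neg_distrib]
    exact Finset.sum_congr rfl fun k _ => h2 i k
  have e3 : ∑ i, ∑ j, ∑ k, D.tri (D.b i) (D.b j) (D.b k) • D.wedge3 (D.d i) (D.d j) ⁅x, D.d k⁆ =
      - ∑ i, ∑ j, ∑ k, D.tri (D.b i) (D.b j) ⁅x, D.b k⁆ • D.wedge3 (D.d i) (D.d j) (D.d k) := by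
    rw [← Finset.sum_neg_distrib]
    refine Finset.sum_congr rfl fun i _ => ?_
    rw [← Finset.sum_neg_distrib]
    exact Finset.sum_congr rfl fun j _ => h3 i j
  have e0 : D.nu x * D.cubic - D.cubic * D.nu x = (-1 / 12 : ℂ) • ∑ i, ∑ j, ∑ k,
      D.tri (D.b i) (D.b j) (D.b k) • (D.wedge3 ⁅x, D.d i⁆ (D.d j) (D.d k) +
        D.wedge3 (D.d i) ⁅x, D.d j⁆ (D.d k) + D.wedge3 (D.d i) (D.d j) ⁅x, D.d k⁆) := by
    simp only [← nu_comm_wedge3, cubic, smul_sub, Finset.sum_sub_distrib, Finset.mul_sum,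
      Finset.sum_mul, mul_smul_comm, smul_mul_assoc]
  rw [e0]
  simp only [smul_add, Finset.sum_add_distrib]
  rw [← smul_add, ← smul_add, e1, e2, e3, ← neg_add, ← neg_add]
  simp only [← Finset.sum_add_distrib, ← add_smul, tri_inv, zero_smul, Finset.sum_const_zero,
    neg_zero, smul_zero]

/-- `x ↦ x ⊗ 1 + 1 ⊗ ν_*(x)` as a homomorphism of Lie algebras `𝔯 → U(𝔤) ⊗ C(𝔭)`. -/
def zetaLie : D.r →ₗ⁅ℂ⁆ D.UC where
  toFun x := UniversalEnvelopingAlgebra.ι ℂ (x : 𝔤) ⊗ₜ[ℂ] 1 + 1 ⊗ₜ[ℂ] D.nuHom x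
  map_add' x y := by
    have h : ((x + y : D.r) : 𝔤) = (x : 𝔤) + (y : 𝔤) := rfl
    simp only [h, map_add, TensorProduct.add_tmul, TensorProduct.tmul_add]
    abel
  map_smul' c x := by
    have h : ((c • x : D.r) : 𝔤) = c • (x : 𝔤) := rfl
    simp only [h, map_smul, TensorProduct.smul_tmul', TensorProduct.tmul_smul,
      smul_add, RingHom.id_apply]
  map_lie' {x y} := by
    rw [LieRing.of_associative_ring_bracket, LieHom.map_lie, LieSubalgebra.coe_bracket,
      LieHom.map_lie, LieRing.of_associative_ring_bracket, LieRing.of_associative_ring_bracket]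
    simp only [mul_add, add_mul, Algebra.TensorProduct.tmul_mul_tmul, one_mul, mul_one,
      TensorProduct.sub_tmul, TensorProduct.tmul_sub]
    abel

/-- The algebra homomorphism `ζ : U(𝔯) → U(𝔤) ⊗ C(𝔭)`. -/
def zeta : UniversalEnvelopingAlgebra ℂ D.r →ₐ[ℂ] D.UC :=
  UniversalEnvelopingAlgebra.lift ℂ D.zetaLie

theorem zetaLie_commute_dirac (x : D.r) : Commute (D.zetaLie x) D.dirac := by
  have h1 : D.zetaLie x * (1 ⊗ₜ[ℂ] D.cubic) - (1 ⊗ₜ[ℂ] D.cubic) * D.zetaLie x = 0 := by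
    change (UniversalEnvelopingAlgebra.ι ℂ (x : 𝔤) ⊗ₜ[ℂ] 1 + 1 ⊗ₜ[ℂ] D.nu x) * _ -
      _ * (UniversalEnvelopingAlgebra.ι ℂ (x : 𝔤) ⊗ₜ[ℂ] 1 + 1 ⊗ₜ[ℂ] D.nu x) = 0
    simp only [mul_add, add_mul, Algebra.TensorProduct.tmul_mul_tmul, one_mul, mul_one]
    rw [add_sub_add_left_eq_sub, ← TensorProduct.tmul_sub, nu_comm_cubic, TensorProduct.tmul_zero]
  let β : D.p →ₗ[ℂ] D.p →ₗ[ℂ] D.UC := LinearMap.mk₂ ℂ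
    (fun y z => UniversalEnvelopingAlgebra.ι ℂ (y : 𝔤) ⊗ₜ[ℂ] D.γ z)
    (fun a b c => by simp [TensorProduct.add_tmul])
    (fun t a b => by simp [TensorProduct.smul_tmul'])
    (fun a b c => by simp [TensorProduct.tmul_add])
    (fun t a b => by simp)
  have h2 : ∀ i, D.zetaLie x * β (D.b i) (D.d i) - β (D.b i) (D.d i) * D.zetaLie x =
      β ⁅x, D.b i⁆ (D.d i) + β (D.b i) ⁅x, D.d i⁆ := by
    intro i
    change (UniversalEnvelopingAlgebra.ι ℂ (x : 𝔤) ⊗ₜ[ℂ] 1 + 1 ⊗ₜ[ℂ] D.nu x) *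
        (UniversalEnvelopingAlgebra.ι ℂ (D.b i : 𝔤) ⊗ₜ[ℂ] D.γ (D.d i)) -
      (UniversalEnvelopingAlgebra.ι ℂ (D.b i : 𝔤) ⊗ₜ[ℂ] D.γ (D.d i)) *
        (UniversalEnvelopingAlgebra.ι ℂ (x : 𝔤) ⊗ₜ[ℂ] 1 + 1 ⊗ₜ[ℂ] D.nu x) =
      UniversalEnvelopingAlgebra.ι ℂ ⁅(x : 𝔤), (D.b i : 𝔤)⁆ ⊗ₜ[ℂ] D.γ (D.d i) +
        UniversalEnvelopingAlgebra.ι ℂ (D.b i : 𝔤) ⊗ₜ[ℂ] D.γ ⁅x, D.d i⁆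
    rw [← nu_comm, LieHom.map_lie, LieRing.of_associative_ring_bracket]
    simp only [mul_add, add_mul, Algebra.TensorProduct.tmul_mul_tmul, one_mul, mul_one,
      TensorProduct.sub_tmul, TensorProduct.tmul_sub]
    abel
  have h3 := D.canonical_inv β x
  refine sub_eq_zero.1 ?_
  have h4 : D.dirac = ∑ i, β (D.b i) (D.d i) + 1 ⊗ₜ[ℂ] D.cubic := rfl
  rw [h4, mul_add, add_mul, add_sub_add_comm, h1, add_zero, Finset.mul_sum, Finset.sum_mul,
    ← Finset.sum_sub_distrib]
  simp only [h2]
  rw [Finset.sum_add_distrib, h3, add_neg_cancel]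

/-- `ζ(U(𝔯))` commutes with `□`. -/
theorem zeta_commute_dirac (a : UniversalEnvelopingAlgebra ℂ D.r) :
    Commute (D.zeta a) D.dirac := by
  let ψ : UniversalEnvelopingAlgebra ℂ D.r →ₐ[ℂ] Subalgebra.centralizer ℂ {D.dirac} :=
    UniversalEnvelopingAlgebra.lift ℂ
      { toFun := fun x => ⟨D.zetaLie x, (Subalgebra.mem_centralizer_iff ℂ).2 (by
          rintro _ rfl
          exact (D.zetaLie_commute_dirac x).symm)⟩
        map_add' := fun x y => Subtype.ext (map_add D.zetaLie x y)
        map_smul' := fun c x => Subtype.ext (map_smul D.zetaLie c x)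
        map_lie' := fun {x y} => Subtype.ext (D.zetaLie.map_lie x y) }
  have h : D.zeta = (Subalgebra.val _).comp ψ := by
    refine UniversalEnvelopingAlgebra.hom_ext ℂ ?_
    ext x
    simp only [LieHom.comp_apply, AlgHom.coe_toLieHom, AlgHom.comp_apply, zeta, ψ,
      UniversalEnvelopingAlgebra.lift_ι_apply]
    rfl
  rw [h]
  exact ((Subalgebra.mem_centralizer_iff ℂ).1 (ψ a).2 D.dirac (Set.mem_singleton _)).symm

/-- `Z(𝔤) ⊗ 1` commutes with `□`. -/
theorem center_commute_dirac (z : Subalgebra.center ℂ (UniversalEnvelopingAlgebra ℂ 𝔤)) :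
    Commute ((z : UniversalEnvelopingAlgebra ℂ 𝔤) ⊗ₜ[ℂ] (1 : D.Cl)) D.dirac := by
  have h : ∀ a : D.UC, Commute ((z : UniversalEnvelopingAlgebra ℂ 𝔤) ⊗ₜ[ℂ] (1 : D.Cl)) a := by
    intro a
    induction a using TensorProduct.induction_on with
    | zero => exact Commute.zero_right _
    | tmul y c =>
      have hz := Subalgebra.mem_center_iff.1 z.2 y
      simp only [Commute, SemiconjBy, Algebra.TensorProduct.tmul_mul_tmul, one_mul, mul_one, hz]
    | add a b ha hb => exact ha.add_right hb
  exact h _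

/-! ### Dirac cohomology -/

section Modules

variable (V : Type*) [AddCommGroup V] [Module ℂ V] [Module (UniversalEnvelopingAlgebra ℂ 𝔤) V]
  [IsScalarTower ℂ (UniversalEnvelopingAlgebra ℂ 𝔤) V]
  (L : Type*) [AddCommGroup L] [Module ℂ L] [Module D.Cl L] [IsScalarTower ℂ D.Cl L]

/-- The action `ξ` of `U(𝔤) ⊗ C(𝔭)` on `V ⊗ L`. -/
def xi : D.UC →ₐ[ℂ] Module.End ℂ (V ⊗[ℂ] L) :=
  Module.endTensorEndAlgHom.comp
    (Algebra.TensorProduct.map (Algebra.lsmul ℂ ℂ V) (Algebra.lsmul ℂ ℂ L))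

/-- The operator `□_V = ξ(□)` on `V ⊗ L`. -/
abbrev diracOp : Module.End ℂ (V ⊗[ℂ] L) := D.xi V L D.dirac

/-- The Dirac cohomology `H_D(V ⊗ L)`. -/
abbrev DiracCohomology : Type _ := Cohomology (D.diracOp V L)

/-- The action of `Z(𝔤) ⊗ 1` on `H_D(V ⊗ L)`. -/
def centerAction : Subalgebra.center ℂ (UniversalEnvelopingAlgebra ℂ 𝔤) →ₐ[ℂ]
    Module.End ℂ (D.DiracCohomology V L) :=
  (cohomologyAction (D.diracOp V L)).comp
    ((((D.xi V L).comp (Algebra.TensorProduct.includeLeft (R := ℂ) (S := ℂ))).comp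
      (Subalgebra.val _)).codRestrict _ fun z => (Subalgebra.mem_centralizer_iff ℂ).2 (by
        rintro _ rfl
        exact ((D.center_commute_dirac z).map (D.xi V L)).symm))

/-- The action of `Z(𝔯)` on `H_D(V ⊗ L)` through `ζ`. -/
def zetaAction : Subalgebra.center ℂ (UniversalEnvelopingAlgebra ℂ D.r) →ₐ[ℂ]
    Module.End ℂ (D.DiracCohomology V L) :=
  (cohomologyAction (D.diracOp V L)).comp
    ((((D.xi V L).comp D.zeta).comp (Subalgebra.val _)).codRestrict _
      fun z => (Subalgebra.mem_centralizer_iff ℂ).2 (by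
        rintro _ rfl
        exact ((D.zeta_commute_dirac z).map (D.xi V L)).symm))

end Modules

/-! ### Cartan subalgebra, positive roots, and the Dirac cocycles -/

/-- `x ∈ 𝔥` is hyperbolic if all roots are real on it. -/
def IsHyperbolic (h : LieSubalgebra ℂ 𝔤) [h.IsCartanSubalgebra] (x : h) : Prop :=
  ∀ α : LieModule.Weight ℂ h 𝔤, (α x).im = 0

/-- A Cartan subalgebra `𝔥` of `𝔤` containing a Cartan subalgebra `𝔥_𝔯 = 𝔥 ∩ 𝔯` of `𝔯`, and a
positive system of the roots compatible with `𝔯`. Let `𝔥#` be the real space of hyperbolic elements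
of `𝔥` and `κ : 𝔥 → 𝔥#` the real projection with kernel `i 𝔥#`. The positive roots are those which
are positive at a regular element `f ∈ 𝔥#`, which is in the interior of a closed Weyl chamber
containing an element `f_𝔯 ∈ κ(𝔥_𝔯)` that has the same centralizer in `𝔤` as `𝔥_𝔯`. -/
structure CartanData where
  h : LieSubalgebra ℂ 𝔤
  cartan : h.IsCartanSubalgebra
  cartan_r : (h.comap D.r.incl).IsCartanSubalgebra
  fr : h
  fr_hyperbolic : IsHyperbolic h fr
  fr_mem : ∃ z : h, IsHyperbolic h z ∧ ((fr + Complex.I • z : h) : 𝔤) ∈ D.r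
  fr_centralizer : ∀ x : 𝔤, ⁅(fr : 𝔤), x⁆ = 0 ↔ ∀ t ∈ h, t ∈ D.r → ⁅t, x⁆ = 0
  f : h
  f_hyperbolic : IsHyperbolic h f
  f_regular : ∀ α : LieModule.Weight ℂ h 𝔤, α.IsNonZero → α f ≠ 0
  f_chamber : ∀ α : LieModule.Weight ℂ h 𝔤, 0 < (α f).re → 0 ≤ (α fr).re

namespace CartanData

attribute [instance] CartanData.cartan CartanData.cartan_r

variable {D} (T : D.CartanData)

/-- The sum of the root spaces for the roots which are positive at `x`. -/
def posPart (x : T.h) : LieSubmodule ℂ T.h 𝔤 :=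
  ⨆ (α : LieModule.Weight ℂ T.h 𝔤) (_ : 0 < (α x).re), LieAlgebra.rootSpace T.h α

/-- The nilradical `𝔫` of the Borel subalgebra `𝔟 = 𝔥 + 𝔫`. -/
abbrev n : LieSubmodule ℂ T.h 𝔤 := T.posPart T.f

/-- The nilradical of the parabolic subalgebra `𝔮` defined by `f_𝔯`, which is the span of the
eigenvectors of `ad f_𝔯` with positive eigenvalues. -/
abbrev nilradQ : LieSubmodule ℂ T.h 𝔤 := T.posPart T.fr

open scoped Classical in
/-- Half the sum of the positive roots. -/
def rho : Module.Dual ℂ T.h :=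
  (1 / 2 : ℂ) • ∑ α ∈ T.h.root with 0 < (α T.f).re, LieModule.Weight.toLinear ℂ T.h 𝔤 α

/-- The Cartan subalgebra `𝔥_𝔯 = 𝔥 ∩ 𝔯` of `𝔯`. -/
abbrev hr : LieSubalgebra ℂ D.r := T.h.comap D.r.incl

/-- The inclusion `𝔥_𝔯 → 𝔥`. -/
def hrIncl : T.hr →ₗ[ℂ] T.h where
  toFun x := ⟨((x : D.r) : 𝔤), x.2⟩
  map_add' _ _ := rfl
  map_smul' _ _ := rfl

/-- Restriction of linear functionals from `𝔥` to `𝔥_𝔯`. -/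
def restrictHr (μ : Module.Dual ℂ T.h) : Module.Dual ℂ T.hr := μ ∘ₗ T.hrIncl

/-- `𝔫_𝔯 = 𝔫 ∩ 𝔯`, the nilradical of the Borel subalgebra `𝔥_𝔯 + 𝔫_𝔯` of `𝔯`. -/
def nr : LieSubmodule ℂ T.hr D.r where
  __ := T.n.toSubmodule.comap D.r.toSubmodule.subtype
  lie_mem := by
    intro t x hx
    exact T.n.lie_mem (x := T.hrIncl t) hx

/-- `𝔭⁺ = 𝔭 ∩ nilrad 𝔮`. -/
def pPlus : LieSubmodule ℂ T.hr D.p where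
  __ := T.nilradQ.toSubmodule.comap D.p.toSubmodule.subtype
  lie_mem := by
    intro t x hx
    exact T.nilradQ.lie_mem (x := T.hrIncl t) hx

/-- `x ↦ 1/2 tr (ad x | 𝔫_𝔯)`. -/
def rhoR : Module.Dual ℂ T.hr :=
  (1 / 2 : ℂ) • (LinearMap.trace ℂ T.nr ∘ₗ (LieModule.toEnd ℂ T.hr T.nr).toLinearMap)

/-- `x ↦ 1/2 tr (ad x | 𝔭⁺)`. -/
def rhoP : Module.Dual ℂ T.hr :=
  (1 / 2 : ℂ) • (LinearMap.trace ℂ T.pPlus ∘ₗ (LieModule.toEnd ℂ T.hr T.pPlus).toLinearMap)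

/-- The Harish-Chandra homomorphism `A_𝔤`. -/
def AG (z : Subalgebra.center ℂ (UniversalEnvelopingAlgebra ℂ 𝔤)) : SymmetricAlgebra ℂ T.h :=
  harishChandra T.h T.n.toSubmodule T.rho z

/-- The Harish-Chandra homomorphism `A_𝔯`. -/
def AR (z : Subalgebra.center ℂ (UniversalEnvelopingAlgebra ℂ D.r)) : SymmetricAlgebra ℂ T.hr :=
  harishChandra T.hr T.nr.toSubmodule T.rhoR z

/-- `𝔥_𝔭 = 𝔥 ∩ 𝔭`, as a subspace of `𝔭`. -/
def hp : Submodule ℂ D.p := T.h.toSubmodule.comap D.p.toSubmodule.subtype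

/-- `𝔫_𝔭 = 𝔫 ∩ 𝔭`, as a subspace of `𝔭`. -/
def np : Submodule ℂ D.p := T.n.toSubmodule.comap D.p.toSubmodule.subtype

/-- `C(𝔥_𝔭)`, as a subalgebra of `C(𝔭)`. -/
def clHp : Subalgebra ℂ D.Cl := Algebra.adjoin ℂ (D.γ '' (T.hp : Set D.p))

section Basis

variable {m : ℕ} (e : Module.Basis (Fin m) ℂ T.np)

/-- The product `u` in `C(𝔭)` of the elements of a basis of `𝔫_𝔭`. -/
def u : D.Cl := (List.ofFn fun i => D.γ (e i : D.p)).prod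

/-- The left ideal `L = C(𝔭) u`. -/
abbrev L : Submodule D.Cl D.Cl := Submodule.span D.Cl {T.u e}

/-- `u` as an element of `L`. -/
def uL : T.L e := ⟨T.u e, Submodule.mem_span_singleton_self _⟩

variable (lam : Module.Dual ℂ T.h)

/-- The irreducible `𝔤`-module `V_λ` of highest weight `λ`. -/
abbrev V : Type _ := SimpleHW T.h T.n.toSubmodule lam

/-- The subspace `ℂ v_λ ⊗ C(𝔥_𝔭) u` of `V_λ ⊗ L`. -/
def cocycles : Submodule ℂ (T.V lam ⊗[ℂ] T.L e) :=
  Submodule.span ℂ {w | ∃ a ∈ T.clHp, w = hwVector T.h T.n.toSubmodule lam ⊗ₜ[ℂ] (a • T.uL e)}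

/-- The image of the Dirac cocycles `ℂ v_λ ⊗ C(𝔥_𝔭) u` in `H_D(V_λ ⊗ L)`. -/
def E : Submodule ℂ (D.DiracCohomology (T.V lam) (T.L e)) :=
  ((T.cocycles e lam).submoduleOf (LinearMap.ker (D.diracOp (T.V lam) (T.L e)))).map
    (cohomologyClass (D.diracOp (T.V lam) (T.L e)))

end Basis

end CartanData

end QuadraticPair
end CubicDirac
end

/-!
The three statements about `v_λ ⊗ a u`, `a ∈ C(𝔥_𝔭)`, only use that `w = a u` is killed by left
multiplication with `𝔫_𝔭`, and that `𝔟 = 𝔥 + 𝔫` acts on `v_λ` through `λ`.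

*The Dirac operator.* Let `N = 𝔫_𝔭` and `B = 𝔟 ∩ 𝔭`, which is the orthocomplement of `N` in `𝔭`. The
projections of `𝔤` to `𝔫` and to the opposite nilradical are adjoint to each other and preserve `𝔭`;
they split the canonical element of `𝔭 ⊗ 𝔭` into a part in `B ⊗ 𝔭` and a part in `𝔭 ⊗ N`
(`Polarization.sum_split`). In the sum defining the cubic element, only the terms with exactly one
vector in `N` contribute to the action on `w`, because `([x, y], z)` vanishes on `B`. The result is
that the cubic element acts as Clifford multiplication by the vector of `𝔭` representing `τ/2`, where
`τ(y)` is the trace of `ad y` on `𝔫_𝔭`, compressed to `𝔭` (`Polarization.cubic_mul`). For `y ∈ B`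
this is the trace of `ad y` on all of `𝔫`, since `ad y` maps `𝔯` to `𝔭`, so that
`τ = 2ρ` on `𝔥_𝔭` and `τ = 0` on `𝔫_𝔭` (`tau_borel`). The remaining part of the Dirac operator
contributes `λ`, and `λ + ρ` vanishes on `𝔥_𝔭` (`Polarization.diracOp_tmul`).

*The action of the centers.* The same computation shows that `ν_*(x) w = τ(x)/2 • w` for `x` in
`𝔥_𝔯 + 𝔫_𝔯` (`Polarization.nu_mul`), with `τ/2 = ρ_𝔭 = ρ - ρ_𝔯` on `𝔥_𝔯` (`tau_hr`, `rhoP_add_rhoR`)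
and `τ = 0` on `𝔫_𝔯` (`tau_nr`). Hence `v_λ ⊗ w` is a vector of highest weight `λ + ρ - ρ_𝔯` for the
action of `𝔯` through `ζ`, and the center acts by the value of the Harish-Chandra projection at this
weight (`center_smul_highestWeight`), as it does for `𝔤`. The existence of this projection
(`exists_congruentModN`) needs only the spanning half of the Poincaré–Birkhoff–Witt theorem.

*Compatibility of `𝔫` with `𝔤 = 𝔯 + 𝔭`.* This is what makes the traces computable. An element
`t₀` of `𝔥_𝔯` whose image under `κ` is `f_𝔯` has the same positive weights as `f_𝔯`. Operators
commuting with `ad t₀`, such as the projection to `𝔭`, commute with the projection to the sum of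
the root spaces which are positive on `f_𝔯`, the nilradical of a parabolic subalgebra `𝔮`. The part
of `𝔫` not in this nilradical centralizes `𝔥_𝔯`, and therefore lies in `𝔭` (`projR_zer_fr_pos_f`).
-/

noncomputable section

namespace CubicDirac

/-! ### Scalars on cohomology -/

/-- An operator which commutes with `d` and multiplies the members of a set by a fixed scalar acts
by this scalar on the image of their span in the cohomology of `d`. -/
theorem cohomologyAction_eq_smul {M : Type*} [AddCommGroup M] [Module ℂ M] (d : Module.End ℂ M)
    (s : Subalgebra.centralizer ℂ {d}) (X : Set M) (c : ℂ) (hs : ∀ x ∈ X, s.1 x = c • x) :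
    ∀ w ∈ ((Submodule.span ℂ X).submoduleOf (LinearMap.ker d)).map (cohomologyClass d),
      cohomologyAction d s w = c • w := by
  have hX : Submodule.span ℂ X ≤ LinearMap.eqLocus s.1 (c • LinearMap.id) :=
    Submodule.span_le.2 hs
  rintro _ ⟨k, hk, rfl⟩
  have h : kerRestrict d s k = c • k := Subtype.ext (hX hk)
  rw [← map_smul, ← h]
  rfl

/-! ### The Harish-Chandra projection -/

section HarishChandra

variable {𝔞 : Type*} [LieRing 𝔞] [LieAlgebra ℂ 𝔞]

local notation "U" => UniversalEnvelopingAlgebra ℂ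
local notation "jU" => UniversalEnvelopingAlgebra.ι ℂ

/-- A subspace of `U(𝔞)` that contains `1` and is stable under left multiplication by `𝔞` is
everything. -/
theorem eq_top_of_lie_mul_mem (W : Submodule ℂ (U 𝔞)) (h1 : (1 : U 𝔞) ∈ W)
    (hW : ∀ (x : 𝔞), ∀ w ∈ W, jU x * w ∈ W) : W = ⊤ := by
  let A : Subalgebra ℂ (U 𝔞) :=
    { carrier := {a | ∀ w ∈ W, a * w ∈ W}
      mul_mem' := fun {a b} ha hb w hw => by rw [mul_assoc]; exact ha _ (hb _ hw)
      add_mem' := fun {a b} ha hb w hw => by rw [add_mul]; exact W.add_mem (ha _ hw) (hb _ hw)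
      algebraMap_mem' := fun r w hw => by
        rw [Algebra.algebraMap_eq_smul_one, smul_mul_assoc, one_mul]; exact W.smul_mem _ hw }
  let g : 𝔞 →ₗ⁅ℂ⁆ A :=
    { toFun := fun x => ⟨jU x, hW x⟩
      map_add' := fun x y => Subtype.ext (map_add jU x y)
      map_smul' := fun c x => Subtype.ext (map_smul jU c x)
      map_lie' := fun {x y} => Subtype.ext (LieHom.map_lie jU x y) }
  have h : A.val.comp (UniversalEnvelopingAlgebra.lift ℂ g) = AlgHom.id ℂ (U 𝔞) := by
    refine UniversalEnvelopingAlgebra.hom_ext ℂ ?_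
    ext x
    simp only [LieHom.comp_apply, AlgHom.coe_toLieHom, AlgHom.comp_apply,
      UniversalEnvelopingAlgebra.lift_ι_apply]
    rfl
  refine eq_top_iff.2 fun a _ => ?_
  have ha : a ∈ A := by
    have := DFunLike.congr_fun h a
    rw [AlgHom.id_apply] at this
    rw [← this]
    exact (UniversalEnvelopingAlgebra.lift ℂ g a).2
  simpa using ha 1 h1

/-- The canonical homomorphism `T(𝔱) → U(𝔞)`. -/
def tensorToEnveloping (𝔱 : LieSubalgebra ℂ 𝔞) : TensorAlgebra ℂ 𝔱 →ₐ[ℂ] U 𝔞 :=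
  TensorAlgebra.lift ℂ
    ((UniversalEnvelopingAlgebra.ι ℂ : 𝔞 →ₗ⁅ℂ⁆ U 𝔞).toLinearMap ∘ₗ 𝔱.toSubmodule.subtype)

theorem tensorToEnveloping_ι (𝔱 : LieSubalgebra ℂ 𝔞) (x : 𝔱) :
    tensorToEnveloping 𝔱 (TensorAlgebra.ι ℂ x) = jU (x : 𝔞) :=
  TensorAlgebra.lift_ι_apply _ _

theorem ι_mul_ι (x y : 𝔞) : jU x * jU y = jU y * jU x + jU ⁅x, y⁆ := by
  rw [LieHom.map_lie, LieRing.of_associative_ring_bracket]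
  abel

variable (𝔱 : LieSubalgebra ℂ 𝔞) (𝔫 : Submodule ℂ 𝔞)

theorem commute_tensorToEnveloping {t₀ : 𝔞} (ht₀ : ∀ t ∈ 𝔱, ⁅t₀, t⁆ = 0)
    (w : TensorAlgebra ℂ 𝔱) : jU t₀ * tensorToEnveloping 𝔱 w = tensorToEnveloping 𝔱 w * jU t₀ := by
  induction w using TensorAlgebra.induction with
  | algebraMap r => rw [AlgHom.commutes, Algebra.commutes]
  | ι t => rw [tensorToEnveloping_ι, ι_mul_ι, ht₀ t t.2, map_zero, add_zero]
  | mul a b ha hb => rw [map_mul, ← mul_assoc, ha, mul_assoc, hb, mul_assoc]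
  | add a b ha hb => rw [map_add, mul_add, add_mul, ha, hb]

theorem ι_mem_leftIdeal {x : 𝔞} (hx : x ∈ 𝔫) : jU x ∈ leftIdeal 𝔫 :=
  Submodule.subset_span ⟨x, hx, rfl⟩

/-- Elements of `𝔫` can be moved to the right through `U(𝔱)`. -/
theorem ι_mul_tensor_mem (hn : ∀ t ∈ 𝔱, ∀ x ∈ 𝔫, ⁅t, x⁆ ∈ 𝔫) (w : TensorAlgebra ℂ 𝔱) :
    ∀ x ∈ 𝔫, jU x * tensorToEnveloping 𝔱 w ∈ leftIdeal 𝔫 := by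
  -- For the product step the statement must allow an arbitrary element of the left ideal.
  suffices h : ∀ j ∈ leftIdeal 𝔫, j * tensorToEnveloping 𝔱 w ∈ leftIdeal 𝔫 from
    fun x hx => h _ (ι_mem_leftIdeal 𝔫 hx)
  induction w using TensorAlgebra.induction with
  | algebraMap r =>
    intro j hj
    rw [AlgHom.commutes, ← Algebra.commutes]
    exact Submodule.smul_mem _ (algebraMap ℂ (U 𝔞) r) hj
  | ι t =>
    intro j hj
    rw [tensorToEnveloping_ι]
    induction hj using Submodule.span_induction with
    | mem y hy =>
      obtain ⟨x, hx, rfl⟩ := hy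
      rw [ι_mul_ι]
      refine Submodule.add_mem _ (Submodule.smul_mem _ (jU (t : 𝔞)) (ι_mem_leftIdeal 𝔫 hx)) ?_
      rw [← lie_skew]
      exact ι_mem_leftIdeal 𝔫 (𝔫.neg_mem (hn t t.2 x hx))
    | zero => rw [zero_mul]; exact Submodule.zero_mem _
    | add a b _ _ ha hb => rw [add_mul]; exact Submodule.add_mem _ ha hb
    | smul a y _ hy =>
      rw [smul_eq_mul, mul_assoc]
      exact Submodule.smul_mem _ a hy
  | mul a b ha hb =>
    intro j hj
    rw [map_mul, ← mul_assoc]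
    exact hb _ (ha _ hj)
  | add a b ha hb =>
    intro j hj
    rw [map_add, mul_add]
    exact Submodule.add_mem _ (ha _ hj) (hb _ hj)

/-- The smallest subspace of `U(𝔞)` that contains the image of `U(𝔱)` and is stable under left
multiplication by `𝔪`; it is spanned by the products `y₁ ⋯ y_k s` with `y_i ∈ 𝔪` and `s` in that
image. -/
def orderedProducts (𝔪 : Submodule ℂ 𝔞) : Submodule ℂ (U 𝔞) :=
  sInf {W | (∀ w, tensorToEnveloping 𝔱 w ∈ W) ∧ ∀ y ∈ 𝔪, ∀ w ∈ W, jU y * w ∈ W}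

theorem tensor_mem_orderedProducts (𝔪 : Submodule ℂ 𝔞) (w : TensorAlgebra ℂ 𝔱) :
    tensorToEnveloping 𝔱 w ∈ orderedProducts 𝔱 𝔪 :=
  (Submodule.mem_sInf).2 fun _ hW => hW.1 w

theorem ι_mul_mem_orderedProducts (𝔪 : Submodule ℂ 𝔞) {y : 𝔞} (hy : y ∈ 𝔪) {w : U 𝔞}
    (hw : w ∈ orderedProducts 𝔱 𝔪) : jU y * w ∈ orderedProducts 𝔱 𝔪 :=
  (Submodule.mem_sInf).2 fun W hW => hW.2 y hy w ((Submodule.mem_sInf).1 hw W hW)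

/-- The spanning half of the Poincaré–Birkhoff–Witt theorem, for the decomposition
`𝔞 = 𝔪 + 𝔱 + 𝔫`. -/
theorem orderedProducts_sup_leftIdeal (𝔪 : Submodule ℂ 𝔞)
    (hn : ∀ t ∈ 𝔱, ∀ x ∈ 𝔫, ⁅t, x⁆ ∈ 𝔫) (htop : 𝔪 ⊔ 𝔱.toSubmodule ⊔ 𝔫 = ⊤) :
    orderedProducts 𝔱 𝔪 ⊔ (leftIdeal 𝔫).restrictScalars ℂ = ⊤ := by
  set W := orderedProducts 𝔱 𝔪 with hWdef
  set J := (leftIdeal 𝔫).restrictScalars ℂ with hJdef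
  have hJ : ∀ (a : U 𝔞), ∀ j ∈ J, a * j ∈ J := fun a j hj =>
    Submodule.smul_mem (leftIdeal 𝔫) a hj
  have hm : ∀ y ∈ 𝔪, ∀ w ∈ W ⊔ J, jU y * w ∈ W ⊔ J := by
    intro y hy w hw
    obtain ⟨a, ha, j, hj, rfl⟩ := Submodule.mem_sup.1 hw
    rw [mul_add]
    exact Submodule.add_mem_sup (ι_mul_mem_orderedProducts 𝔱 𝔪 hy ha) (hJ _ _ hj)
  -- The subspace of those `w` for which `x w ∈ W + J` for every `x ∈ 𝔞` contains `U(𝔱)`, and is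
  -- stable under `𝔪` inside `W + J` because `x y w = y x w + [x, y] w`.
  let S : Submodule ℂ (U 𝔞) :=
    { carrier := {w | w ∈ W ⊔ J ∧ ∀ x : 𝔞, jU x * w ∈ W ⊔ J}
      zero_mem' := ⟨Submodule.zero_mem _, fun x => by rw [mul_zero]; exact Submodule.zero_mem _⟩
      add_mem' := fun {a b} ha hb => ⟨Submodule.add_mem _ ha.1 hb.1, fun x => by
        rw [mul_add]; exact Submodule.add_mem _ (ha.2 x) (hb.2 x)⟩
      smul_mem' := fun c a ha => ⟨Submodule.smul_mem _ c ha.1, fun x => by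
        rw [mul_smul_comm]; exact Submodule.smul_mem _ c (ha.2 x)⟩ }
  have hWS : W ≤ S := by
    refine sInf_le ⟨fun w => ⟨Submodule.mem_sup_left (tensor_mem_orderedProducts 𝔱 𝔪 w),
      fun x => ?_⟩, fun y hy w hw => ⟨hm y hy w hw.1, fun x => ?_⟩⟩
    · have hx : x ∈ 𝔪 ⊔ 𝔱.toSubmodule ⊔ 𝔫 := htop ▸ Submodule.mem_top
      obtain ⟨yt, hyt, e, he, rfl⟩ := Submodule.mem_sup.1 hx
      obtain ⟨y, hy, t, ht, rfl⟩ := Submodule.mem_sup.1 hyt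
      rw [map_add, map_add, add_mul, add_mul]
      refine Submodule.add_mem _ (Submodule.add_mem _ ?_ ?_) ?_
      · exact Submodule.mem_sup_left
          (ι_mul_mem_orderedProducts 𝔱 𝔪 hy (tensor_mem_orderedProducts 𝔱 𝔪 w))
      · refine Submodule.mem_sup_left ?_
        have := tensor_mem_orderedProducts 𝔱 𝔪 (TensorAlgebra.ι ℂ (⟨t, ht⟩ : 𝔱) * w)
        rwa [map_mul, tensorToEnveloping_ι] at this
      · exact Submodule.mem_sup_right (ι_mul_tensor_mem 𝔱 𝔫 hn w e he)
    · rw [← mul_assoc, ι_mul_ι, add_mul, mul_assoc]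
      exact Submodule.add_mem _ (hm y hy _ (hw.2 x)) (hw.2 _)
  refine eq_top_of_lie_mul_mem _ (Submodule.mem_sup_left ?_) fun x w hw => ?_
  · simpa using tensor_mem_orderedProducts 𝔱 𝔪 1
  · obtain ⟨a, ha, j, hj, rfl⟩ := Submodule.mem_sup.1 hw
    rw [mul_add]
    exact Submodule.add_mem _ ((hWS ha).2 x) (Submodule.mem_sup_right (hJ _ _ hj))

/-- The commutator with `jU t` in `U(𝔞)`. -/
def adEnveloping (t : 𝔞) : Module.End ℂ (U 𝔞) :=
  LinearMap.mulLeft ℂ (jU t) - LinearMap.mulRight ℂ (jU t)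

theorem adEnveloping_apply (t : 𝔞) (w : U 𝔞) : adEnveloping t w = jU t * w - w * jU t := rfl

/-- The sum of the eigenspaces of an endomorphism for the eigenvalues with negative real part. -/
def negEigen {M : Type*} [AddCommGroup M] [Module ℂ M] (φ : Module.End ℂ M) : Submodule ℂ M :=
  ⨆ (c : ℂ) (_ : c.re < 0), φ.eigenspace c

theorem mem_negEigen {M : Type*} [AddCommGroup M] [Module ℂ M] {φ : Module.End ℂ M} {c : ℂ}
    (hc : c.re < 0) {x : M} (hx : φ x = c • x) : x ∈ negEigen φ :=
  Submodule.mem_iSup_of_mem c (Submodule.mem_iSup_of_mem hc (Module.End.mem_eigenspace_iff.2 hx))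

theorem negEigen_induction {M : Type*} [AddCommGroup M] [Module ℂ M] {φ : Module.End ℂ M}
    {W : Submodule ℂ M} (h : ∀ (c : ℂ) (x : M), c.re < 0 → φ x = c • x → x ∈ W) :
    negEigen φ ≤ W :=
  iSup₂_le fun c hc x hx => h c x hc (Module.End.mem_eigenspace_iff.1 hx)

theorem orderedProducts_le (t₀ : 𝔞) (ht₀ : ∀ t ∈ 𝔱, ⁅t₀, t⁆ = 0) :
    orderedProducts 𝔱 (negEigen (LieAlgebra.ad ℂ 𝔞 t₀)) ≤
      (tensorToEnveloping 𝔱).range.toSubmodule ⊔ negEigen (adEnveloping t₀) := by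
  have hT : ∀ w, adEnveloping t₀ (tensorToEnveloping 𝔱 w) = 0 := by
    intro w
    rw [adEnveloping_apply, commute_tensorToEnveloping 𝔱 ht₀, sub_self]
  have hder : ∀ a b, adEnveloping t₀ (a * b) = adEnveloping t₀ a * b + a * adEnveloping t₀ b := by
    intro a b
    simp only [adEnveloping_apply]
    noncomm_ring
  have hι : ∀ y, adEnveloping t₀ (jU y) = jU ⁅t₀, y⁆ := by
    intro y
    rw [adEnveloping_apply, ι_mul_ι]
    abel
  refine sInf_le ⟨fun w => Submodule.mem_sup_left ⟨w, rfl⟩, fun y hy w hw => ?_⟩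
  refine Submodule.mem_sup_right ?_
  revert y
  refine fun y hy => negEigen_induction (W := Submodule.comap
    (LinearMap.mulRight ℂ w ∘ₗ (jU : 𝔞 →ₗ⁅ℂ⁆ U 𝔞).toLinearMap) (negEigen (adEnveloping t₀))) ?_ hy
  intro c y hc hy
  change jU y * w ∈ negEigen (adEnveloping t₀)
  rw [LieAlgebra.ad_apply] at hy
  obtain ⟨_, ⟨s, rfl⟩, n, hn, rfl⟩ := Submodule.mem_sup.1 hw
  rw [mul_add]
  refine Submodule.add_mem _ (mem_negEigen hc ?_) ?_
  · change adEnveloping t₀ (jU y * tensorToEnveloping 𝔱 s) = c • (jU y * tensorToEnveloping 𝔱 s)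
    rw [hder, hT, mul_zero, add_zero, hι, hy, map_smul, smul_mul_assoc]
  · refine negEigen_induction (W := Submodule.comap (LinearMap.mulLeft ℂ (jU y))
      (negEigen (adEnveloping t₀))) ?_ hn
    intro c' x hc' hx
    refine mem_negEigen (c := c + c') (by rw [Complex.add_re]; linarith) ?_
    rw [LinearMap.mulLeft_apply, hder, hι, hy, hx, map_smul, smul_mul_assoc, mul_smul_comm, add_smul]

/-- Every element of the center of `U(𝔞)` is congruent modulo `U(𝔞) 𝔫` to an element of `S(𝔱)`.
Here `𝔱` contains an element `t₀` centralizing `𝔱` such that `𝔱`, `𝔫` and the eigenvectors of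
`ad t₀` for eigenvalues with negative real part span `𝔞`. Modulo `U(𝔞) 𝔫`, a central element
is the sum of an element of the image of `S(𝔱)` and of eigenvectors of `ad t₀` with nonzero
eigenvalues; as it has weight `0`, the latter vanish. -/
theorem exists_congruentModN (t₀ : 𝔞) (ht₀m : t₀ ∈ 𝔱) (ht₀ : ∀ t ∈ 𝔱, ⁅t₀, t⁆ = 0)
    (hn : ∀ t ∈ 𝔱, ∀ x ∈ 𝔫, ⁅t, x⁆ ∈ 𝔫)
    (htop : negEigen (LieAlgebra.ad ℂ 𝔞 t₀) ⊔ 𝔱.toSubmodule ⊔ 𝔫 = ⊤)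
    (z : Subalgebra.center ℂ (U 𝔞)) : ∃ s, CongruentModN 𝔱 𝔫 (z : U 𝔞) s := by
  suffices h : ∃ w, (z : U 𝔞) - tensorToEnveloping 𝔱 w ∈ leftIdeal 𝔫 by
    obtain ⟨w, hw⟩ := h
    exact ⟨_, w, rfl, hw⟩
  set J := (leftIdeal 𝔫).restrictScalars ℂ with hJdef
  have hz : (z : U 𝔞) ∈ orderedProducts 𝔱 (negEigen (LieAlgebra.ad ℂ 𝔞 t₀)) ⊔ J :=
    (orderedProducts_sup_leftIdeal 𝔱 𝔫 _ hn htop) ▸ Submodule.mem_top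
  obtain ⟨p, hp, j, hj, hpj⟩ := Submodule.mem_sup.1 hz
  obtain ⟨_, ⟨w, rfl⟩, ν, hν, hsum⟩ := Submodule.mem_sup.1 (orderedProducts_le 𝔱 t₀ ht₀ hp)
  change tensorToEnveloping 𝔱 w + ν = p at hsum
  refine ⟨w, ?_⟩
  -- `U(𝔞) 𝔫` is stable under `ad t₀`.
  have hD : J ≤ J.comap (adEnveloping t₀) := by
    intro a ha
    rw [Submodule.mem_comap, adEnveloping_apply]
    refine Submodule.sub_mem _ (Submodule.smul_mem (leftIdeal 𝔫) (jU t₀) ha) ?_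
    have hmul : ∀ a ∈ leftIdeal 𝔫, a * jU t₀ ∈ leftIdeal 𝔫 := by
      intro a ha
      induction ha using Submodule.span_induction with
      | mem y hy =>
        obtain ⟨x, hx, rfl⟩ := hy
        have := ι_mul_tensor_mem 𝔱 𝔫 hn (TensorAlgebra.ι ℂ ⟨t₀, ht₀m⟩) x hx
        rwa [tensorToEnveloping_ι] at this
      | zero => rw [zero_mul]; exact Submodule.zero_mem _
      | add a b _ _ ha hb => rw [add_mul]; exact Submodule.add_mem _ ha hb
      | smul a y _ hy =>
        rw [smul_eq_mul, mul_assoc]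
        exact Submodule.smul_mem _ a hy
    exact hmul a ha
  let Dbar : Module.End ℂ (U 𝔞 ⧸ J) := J.mapQ J (adEnveloping t₀) hD
  have hDbar : ∀ a, Dbar (J.mkQ a) = J.mkQ (adEnveloping t₀ a) := fun a => rfl
  have h0 : adEnveloping t₀ ((z : U 𝔞) - tensorToEnveloping 𝔱 w) = 0 := by
    rw [adEnveloping_apply, mul_sub, sub_mul, ← Subalgebra.mem_center_iff.1 z.2 (jU t₀)]
    rw [commute_tensorToEnveloping 𝔱 ht₀, sub_self]
  have hzν : (z : U 𝔞) - tensorToEnveloping 𝔱 w = ν + j := by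
    rw [← hpj, ← hsum]
    abel
  have hq : J.mkQ ((z : U 𝔞) - tensorToEnveloping 𝔱 w) = J.mkQ ν := by
    rw [hzν, map_add, (Submodule.Quotient.mk_eq_zero J).2 hj |> fun h => (h : J.mkQ j = 0),
      add_zero]
  have hker : J.mkQ ν ∈ Dbar.eigenspace 0 := by
    rw [Module.End.mem_eigenspace_iff, zero_smul, ← hq, hDbar, h0, map_zero]
  have hneg : J.mkQ ν ∈ ⨆ (c : ℂ) (_ : c ≠ 0), Dbar.eigenspace c := by
    refine negEigen_induction (W := (⨆ (c : ℂ) (_ : c ≠ 0), Dbar.eigenspace c).comap J.mkQ) ?_ hν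
    intro c x hc hx
    have hc0 : c ≠ 0 := by
      rintro rfl
      simp at hc
    refine Submodule.mem_iSup_of_mem c (Submodule.mem_iSup_of_mem hc0 ?_)
    rw [Module.End.mem_eigenspace_iff, hDbar, hx, map_smul]
  have h00 := Submodule.disjoint_def.1 (Module.End.eigenspaces_iSupIndep Dbar 0) _ hker hneg
  rw [h00] at hq
  exact (Submodule.Quotient.mk_eq_zero J).1 hq

/-- The action of the center on a highest weight vector: if the weight is `μ`, then `z` acts as the
scalar `z₀(μ)`. -/
theorem center_smul_highestWeight {M : Type*} [AddCommGroup M] [Module ℂ M]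
    (Φ : U 𝔞 →ₐ[ℂ] Module.End ℂ M) (v : M) (μ : Module.Dual ℂ 𝔱)
    (hv : ∀ x ∈ 𝔫, Φ (jU x) v = 0) (hμ : ∀ t : 𝔱, Φ (jU (t : 𝔞)) v = μ t • v)
    (z : Subalgebra.center ℂ (U 𝔞)) (hz : ∃ s, CongruentModN 𝔱 𝔫 (z : U 𝔞) s) :
    Φ z v = evalSym (hcProjection 𝔱 𝔫 z) μ • v := by
  obtain ⟨w, hw, hmem⟩ := Classical.epsilon_spec hz
  change SymmetricAlgebra.algHom ℂ 𝔱 w = hcProjection 𝔱 𝔫 z at hw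
  change (z : U 𝔞) - tensorToEnveloping 𝔱 w ∈ leftIdeal 𝔫 at hmem
  have h1 : ∀ a ∈ leftIdeal 𝔫, Φ a v = 0 := by
    intro a ha
    induction ha using Submodule.span_induction with
    | mem y hy =>
      obtain ⟨x, hx, rfl⟩ := hy
      exact hv x hx
    | zero => rw [map_zero, LinearMap.zero_apply]
    | add a b _ _ ha hb => rw [map_add, LinearMap.add_apply, ha, hb, add_zero]
    | smul a y _ hy => rw [smul_eq_mul, map_mul, Module.End.mul_apply, hy, map_zero]
  have h2 : Φ (tensorToEnveloping 𝔱 w) v =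
      SymmetricAlgebra.lift μ (SymmetricAlgebra.algHom ℂ 𝔱 w) • v := by
    clear hw hmem
    induction w using TensorAlgebra.induction with
    | algebraMap r =>
      simp only [AlgHom.commutes, Module.algebraMap_end_apply, Algebra.algebraMap_self,
        RingHom.id_apply]
    | ι t =>
      rw [tensorToEnveloping_ι, hμ]
      congr 1
      exact (SymmetricAlgebra.lift_ι_apply μ t).symm
    | mul a b ha hb =>
      simp only [map_mul, Module.End.mul_apply, hb, map_smul, ha, smul_smul]
      rw [mul_comm]
    | add a b ha hb => simp only [map_add, LinearMap.add_apply, ha, hb, add_smul]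
  have h3 := h1 _ hmem
  rw [map_sub, LinearMap.sub_apply, sub_eq_zero] at h3
  rw [h3, h2, hw, evalSym]

/-- The `ρ`-shift in the Harish-Chandra homomorphism. -/
theorem evalSym_harishChandra (ρ μ ν : Module.Dual ℂ 𝔱) (h : ν - ρ = μ)
    (z : Subalgebra.center ℂ (U 𝔞)) :
    evalSym (harishChandra 𝔱 𝔫 ρ z) ν = evalSym (hcProjection 𝔱 𝔫 z) μ := by
  have h1 : (SymmetricAlgebra.lift ν).comp (shift ρ) = SymmetricAlgebra.lift μ := by
    refine SymmetricAlgebra.algHom_ext ?_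
    ext t
    simp [shift, ← h]
  exact DFunLike.congr_fun h1 _

end HarishChandra

/-! ### The cubic element and the spin action on vectors killed by an isotropic subspace -/

namespace QuadraticPair

variable {𝔤 : Type*} [LieRing 𝔤] [LieAlgebra ℂ 𝔤] [FiniteDimensional ℂ 𝔤] (D : QuadraticPair 𝔤)

/-- Mutually adjoint endomorphisms can be moved across the canonical element `∑ b i ⊗ d i`. -/
theorem sum_adjoint {E : Type*} [AddCommGroup E] [Module ℂ E] (β : D.p →ₗ[ℂ] D.p →ₗ[ℂ] E)
    {s s' : D.p →ₗ[ℂ] D.p} (h : ∀ x y, D.formP (s x) y = D.formP x (s' y)) :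
    ∑ i, β (s (D.b i)) (D.d i) = ∑ i, β (D.b i) (s' (D.d i)) := by
  have h1 : ∀ i, β (s (D.b i)) (D.d i) =
      ∑ j, D.formP (D.d j) (s (D.b i)) • β (D.b j) (D.d i) := by
    intro i
    conv_lhs => rw [← D.sum_b (s (D.b i))]
    simp only [map_sum, map_smul, LinearMap.sum_apply, LinearMap.smul_apply]
  have h2 : ∀ i, β (D.b i) (s' (D.d i)) =
      ∑ j, D.formP (D.b j) (s' (D.d i)) • β (D.b i) (D.d j) := by
    intro i
    conv_lhs => rw [← D.sum_d (s' (D.d i))]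
    simp only [map_sum, map_smul]
  simp only [h1, h2]
  rw [Finset.sum_comm]
  refine Finset.sum_congr rfl fun i _ => Finset.sum_congr rfl fun j _ => ?_
  rw [D.formP_symm, h]

/-- The canonical element `∑ b i ⊗ d i` is symmetric. -/
theorem sum_symm {E : Type*} [AddCommGroup E] [Module ℂ E] (β : D.p →ₗ[ℂ] D.p →ₗ[ℂ] E) :
    ∑ i, β (D.b i) (D.d i) = ∑ i, β (D.d i) (D.b i) := by
  have h1 : ∀ i, β (D.b i) (D.d i) = ∑ j, D.formP (D.d j) (D.d i) • β (D.b i) (D.b j) := by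
    intro i
    conv_lhs => rw [← D.sum_b (D.d i)]
    simp only [map_sum, map_smul]
  have h2 : ∀ i, β (D.d i) (D.b i) = ∑ j, D.formP (D.d j) (D.d i) • β (D.b j) (D.b i) := by
    intro i
    conv_lhs => rw [← D.sum_b (D.d i)]
    simp only [map_sum, map_smul, LinearMap.sum_apply, LinearMap.smul_apply]
  simp only [h1, h2]
  rw [Finset.sum_comm]
  exact Finset.sum_congr rfl fun i _ => Finset.sum_congr rfl fun j _ => by rw [D.formP_symm]

/-- Contraction of a linear map against `∑ b i ⊗ d i`. -/
theorem sum_form_smul {E : Type*} [AddCommGroup E] [Module ℂ E] (φ : D.p →ₗ[ℂ] E) (y : D.p) :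
    ∑ i, D.formP y (D.d i) • φ (D.b i) = φ y := by
  conv_rhs => rw [← D.sum_b y]
  simp only [map_sum, map_smul]
  exact Finset.sum_congr rfl fun i _ => by rw [D.formP_symm]

/-- A subspace `N` of `𝔭` and a subspace `B ⊇ N` orthogonal to it, on which the trilinear form
`([x, y], z)` vanishes, together with an endomorphism `s'` of `𝔭` into `N` and its adjoint `s`,
such that `1 - s` maps `𝔭` to `B`. The pair `(s, s')` splits the canonical element of `𝔭 ⊗ 𝔭` into
a part in `B ⊗ 𝔭` and a part in `𝔭 ⊗ N`. In the application `N = 𝔫_𝔭`, `B = 𝔥_𝔭 + 𝔫_𝔭`. -/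
structure Polarization where
  N : Submodule ℂ D.p
  B : Submodule ℂ D.p
  s : D.p →ₗ[ℂ] D.p
  s' : D.p →ₗ[ℂ] D.p
  adjoint : ∀ x y, D.formP (s x) y = D.formP x (s' y)
  s'_mem : ∀ y, s' y ∈ N
  sub_mem : ∀ x, x - s x ∈ B
  le : N ≤ B
  ortho : ∀ n ∈ N, ∀ y ∈ B, D.formP n y = 0
  tri_eq_zero : ∀ x ∈ B, ∀ y ∈ B, ∀ z ∈ B, D.tri x y z = 0

namespace Polarization

variable {D} (P : D.Polarization)

/-- The component `1 - s`, with values in `B`. -/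
def q : D.p →ₗ[ℂ] D.p := LinearMap.id - P.s

theorem q_mem (x : D.p) : P.q x ∈ P.B := P.sub_mem x

theorem sum_split {E : Type*} [AddCommGroup E] [Module ℂ E] (β : D.p →ₗ[ℂ] D.p →ₗ[ℂ] E) :
    ∑ i, β (D.b i) (D.d i) = ∑ i, β (D.b i) (P.s' (D.d i)) + ∑ i, β (P.q (D.b i)) (D.d i) := by
  rw [← D.sum_adjoint β P.adjoint, ← Finset.sum_add_distrib]
  refine Finset.sum_congr rfl fun i _ => ?_
  rw [← LinearMap.add_apply, ← map_add]
  congr 2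
  simp [q]

theorem s_eq_zero {n : D.p} (hn : n ∈ P.N) : P.s n = 0 := by
  refine (LinearMap.BilinForm.Nondegenerate.ker_eq_bot D.formP_nondeg ▸ LinearMap.mem_ker.2
    (LinearMap.ext fun y => ?_) : P.s n ∈ (⊥ : Submodule ℂ D.p))
  rw [P.adjoint, P.ortho n hn _ (P.le (P.s'_mem y)), LinearMap.zero_apply]

theorem q_eq_self {n : D.p} (hn : n ∈ P.N) : P.q n = n := by
  rw [q, LinearMap.sub_apply, P.s_eq_zero hn, sub_zero, LinearMap.id_apply]

/-- For `y ∈ 𝔤`, the trace of the operator `x ↦ pr_𝔭 [y, s' x]` of `𝔭`. -/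
def tau : 𝔤 →ₗ[ℂ] ℂ where
  toFun y := ∑ i, D.form (D.b i : 𝔤) ⁅y, (P.s' (D.d i) : 𝔤)⁆
  map_add' y z := by simp [Finset.sum_add_distrib]
  map_smul' c y := by simp [Finset.mul_sum]

theorem tau_apply (y : 𝔤) : P.tau y = ∑ i, D.form (D.b i : 𝔤) ⁅y, (P.s' (D.d i) : 𝔤)⁆ := rfl

end Polarization

theorem tri_swap (x y z : D.p) : D.tri y x z = - D.tri x y z := by
  unfold tri
  rw [← lie_skew, map_neg, LinearMap.neg_apply]

theorem tri_cycle (x y z : D.p) : D.tri y z x = D.tri x y z := by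
  unfold tri
  have h := D.form_inv (y : 𝔤) (z : 𝔤) (x : 𝔤)
  rw [h, ← D.form_symm.eq]
  rw [← lie_skew (y : 𝔤), map_neg, LinearMap.neg_apply, neg_neg]

theorem tri_swap_right (x y z : D.p) : D.tri x y z = - D.tri x z y := by
  rw [← D.tri_cycle x y z, D.tri_swap, D.tri_cycle]

/-- `([x, y], z)` as a linear function of `y`. -/
def triMid (x z : D.p) : D.p →ₗ[ℂ] ℂ where
  toFun y := D.tri x y z
  map_add' a b := by simp [tri]
  map_smul' c a := by simp [tri]

theorem triMid_apply (x y z : D.p) : D.triMid x z y = D.tri x y z := rfl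

/-- `([x, y], z)` as a linear function of `z`. -/
def triLast (x y : D.p) : D.p →ₗ[ℂ] ℂ where
  toFun z := D.tri x y z
  map_add' a b := by simp [tri]
  map_smul' c a := by simp [tri]

theorem triLast_apply (x y z : D.p) : D.triLast x y z = D.tri x y z := rfl

theorem wedge3_mul_of_first {w : D.Cl} {n : D.p} (hn : D.γ n * w = 0) (y z : D.p) :
    D.wedge3 n y z * w = D.formP n y • (D.γ z * w) - D.formP n z • (D.γ y * w) := by
  have h1 : ∀ (x : D.p) (a : D.Cl), D.γ n * (D.γ x * a) =
      (2 * D.formP n x) • a - D.γ x * (D.γ n * a) := by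
    intro x a
    rw [← mul_assoc, γ_anticomm, sub_mul, Algebra.algebraMap_eq_smul_one, smul_mul_assoc, one_mul,
      mul_assoc]
  rw [wedge3_eq]
  simp only [sub_mul, smul_mul_assoc, mul_assoc, h1, hn, mul_sub, mul_zero, mul_smul_comm]
  module

theorem wedge3_swap (x y z : D.p) : D.wedge3 y x z = - D.wedge3 x y z := by
  have h : ExteriorAlgebra.ι ℂ y * ExteriorAlgebra.ι ℂ x =
      - (ExteriorAlgebra.ι ℂ x * ExteriorAlgebra.ι ℂ y) :=
    eq_neg_of_add_eq_zero_right (by rw [ExteriorAlgebra.ι_add_mul_swap])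
  rw [wedge3, wedge3, ← map_neg, ← mul_assoc, h, neg_mul, mul_assoc]

theorem wedge3_cycle (x y z : D.p) : D.wedge3 y z x = D.wedge3 x y z := by
  have h : ExteriorAlgebra.ι ℂ z * ExteriorAlgebra.ι ℂ x =
      - (ExteriorAlgebra.ι ℂ x * ExteriorAlgebra.ι ℂ z) :=
    eq_neg_of_add_eq_zero_right (by rw [ExteriorAlgebra.ι_add_mul_swap])
  rw [← neg_neg (D.wedge3 x y z), ← D.wedge3_swap x y z, wedge3, wedge3, h, mul_neg, map_neg]

namespace Polarization

variable {D} (P : D.Polarization)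

theorem tau_eq_tri (y : D.p) : P.tau y = - ∑ i, D.tri (D.b i) (P.s' (D.d i)) y := by
  rw [tau_apply, ← Finset.sum_neg_distrib]
  refine Finset.sum_congr rfl fun i _ => ?_
  have h := D.form_inv (P.s' (D.d i) : 𝔤) (D.b i : 𝔤) (y : 𝔤)
  rw [← D.tri_swap, tri, h, ← lie_skew (y : 𝔤), map_neg]

/-- The linear form `y ↦ τ(y)` on `𝔭`. -/
def tauP : D.p →ₗ[ℂ] ℂ := P.tau ∘ₗ D.p.toSubmodule.subtype

/-- The Clifford product of `w` with the vector `∑ τ(b i) d i`, which represents `τ` on `𝔭`. -/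
def tauVec (w : D.Cl) : D.Cl := ∑ i, P.tauP (D.b i) • (D.γ (D.d i) * w)

theorem sum_q_smul {w : D.Cl} (hw : ∀ n ∈ P.N, D.γ n * w = 0) (θ : D.p →ₗ[ℂ] ℂ) :
    ∑ i, θ (P.q (D.b i)) • (D.γ (D.d i) * w) =
    ∑ i, θ (D.b i) • (D.γ (D.d i) * w) := by
  have h := P.sum_split (LinearMap.mk₂ ℂ (fun x y => θ x • (D.γ y * w))
    (fun a b c => by simp [add_smul]) (fun t a b => by simp [smul_smul])
    (fun a b c => by simp [add_mul]) (fun t a b => by simp [smul_smul, mul_comm]))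
  simp only [LinearMap.mk₂_apply] at h
  rw [h, Finset.sum_eq_zero (s := Finset.univ)
    (f := fun i => θ (D.b i) • (D.γ (P.s' (D.d i)) * w)), zero_add]
  intro i _
  rw [hw _ (P.s'_mem _), smul_zero]

/-- The part of the sum defining the cubic element in which one of the three vectors lies in `N`.
The other two are taken in `𝔭` or `B`, through endomorphisms `φ`, `ψ` which are the identity
on `N`. -/
theorem sum_tri_wedge3 {w : D.Cl} (hw : ∀ n ∈ P.N, D.γ n * w = 0)
    (φ ψ : D.p →ₗ[ℂ] D.p) (hφ : ∀ n ∈ P.N, φ n = n) (hψ : ∀ n ∈ P.N, ψ n = n)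
    (hφw : ∑ i, P.tauP (φ (D.b i)) • (D.γ (D.d i) * w) = P.tauVec w)
    (hψw : ∑ i, P.tauP (ψ (D.b i)) • (D.γ (D.d i) * w) = P.tauVec w) :
    ∑ i, ∑ j, ∑ k, D.tri (D.b i) (φ (D.b j)) (ψ (D.b k)) •
      (D.wedge3 (P.s' (D.d i)) (D.d j) (D.d k) * w) = (-2 : ℂ) • P.tauVec w := by
  have h1 : ∀ i, ∑ j, ∑ k, D.tri (D.b i) (φ (D.b j)) (ψ (D.b k)) •
      (D.wedge3 (P.s' (D.d i)) (D.d j) (D.d k) * w) =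
      ∑ k, D.tri (D.b i) (P.s' (D.d i)) (ψ (D.b k)) • (D.γ (D.d k) * w) +
      ∑ k, D.tri (D.b i) (P.s' (D.d i)) (φ (D.b k)) • (D.γ (D.d k) * w) := by
    intro i
    have hn := P.s'_mem (D.d i)
    set n := P.s' (D.d i)
    simp only [D.wedge3_mul_of_first (hw n hn), smul_sub, Finset.sum_sub_distrib]
    rw [sub_eq_add_neg]
    congr 1
    · rw [Finset.sum_comm]
      refine Finset.sum_congr rfl fun k _ => ?_
      have h := D.sum_form_smul (D.triMid (D.b i) (ψ (D.b k)) ∘ₗ φ) n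
      simp only [LinearMap.comp_apply, triMid_apply, hφ n hn] at h
      rw [← h, Finset.sum_smul]
      exact Finset.sum_congr rfl fun j _ => by rw [smul_smul, smul_eq_mul, mul_comm]
    · rw [← Finset.sum_neg_distrib]
      refine Finset.sum_congr rfl fun j _ => ?_
      have h := D.sum_form_smul (D.triLast (D.b i) (φ (D.b j)) ∘ₗ ψ) n
      simp only [LinearMap.comp_apply, triLast_apply, hψ n hn] at h
      rw [D.tri_swap_right, ← h, neg_smul, Finset.sum_smul, ← Finset.sum_neg_distrib]
      simp only [← Finset.sum_neg_distrib]
      refine Finset.sum_congr rfl fun k _ => ?_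
      rw [smul_smul, smul_eq_mul, mul_comm]
  have h2 : ∀ φ : D.p →ₗ[ℂ] D.p, ∑ i, ∑ k, D.tri (D.b i) (P.s' (D.d i)) (φ (D.b k)) •
      (D.γ (D.d k) * w) = - ∑ k, P.tauP (φ (D.b k)) • (D.γ (D.d k) * w) := by
    intro φ
    rw [Finset.sum_comm, ← Finset.sum_neg_distrib]
    refine Finset.sum_congr rfl fun k _ => ?_
    rw [← Finset.sum_smul, ← neg_smul]
    congr 1
    exact (neg_eq_iff_eq_neg.2 (P.tau_eq_tri (φ (D.b k)))).symm
  simp only [h1]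
  rw [Finset.sum_add_distrib, h2, h2, hφw, hψw]
  module

/-- The action of the cubic element on a vector killed by `N`. -/
theorem cubic_mul {w : D.Cl} (hw : ∀ n ∈ P.N, D.γ n * w = 0) :
    D.cubic * w = (1 / 2 : ℂ) • P.tauVec w := by
  have hid : ∑ i, P.tauP ((LinearMap.id : D.p →ₗ[ℂ] D.p) (D.b i)) • (D.γ (D.d i) * w) =
      P.tauVec w := rfl
  have hq : ∑ i, P.tauP (P.q (D.b i)) • (D.γ (D.d i) * w) = P.tauVec w := P.sum_q_smul hw _
  have hidN : ∀ n ∈ P.N, (LinearMap.id : D.p →ₗ[ℂ] D.p) n = n := fun _ _ => rfl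
  have hqN : ∀ n ∈ P.N, P.q n = n := fun _ h => P.q_eq_self h
  -- Split the three slots successively into their parts in `N` and in `B`.
  have s1 : ∑ i, ∑ j, ∑ k, D.tri (D.b i) (D.b j) (D.b k) •
        (D.wedge3 (D.d i) (D.d j) (D.d k) * w) =
      ∑ i, ∑ j, ∑ k, D.tri (D.b i) (D.b j) (D.b k) •
        (D.wedge3 (P.s' (D.d i)) (D.d j) (D.d k) * w) +
      ∑ i, ∑ j, ∑ k, D.tri (P.q (D.b i)) (D.b j) (D.b k) •
        (D.wedge3 (D.d i) (D.d j) (D.d k) * w) := by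
    exact P.sum_split (LinearMap.mk₂ ℂ (fun x y => ∑ j, ∑ k, D.tri x (D.b j) (D.b k) •
      (D.wedge3 y (D.d j) (D.d k) * w))
      (fun a b c => by simp [tri, add_smul, Finset.sum_add_distrib])
      (fun t a b => by simp [tri, smul_smul, Finset.smul_sum])
      (fun a b c => by simp [wedge3, add_mul, Finset.sum_add_distrib])
      (fun t a b => by simp [wedge3, smul_smul, mul_comm, Finset.smul_sum]))
  have s2 : ∑ i, ∑ j, ∑ k, D.tri (P.q (D.b i)) (D.b j) (D.b k) •
        (D.wedge3 (D.d i) (D.d j) (D.d k) * w) =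
      ∑ i, ∑ j, ∑ k, D.tri (P.q (D.b i)) (D.b j) (D.b k) •
        (D.wedge3 (D.d i) (P.s' (D.d j)) (D.d k) * w) +
      ∑ i, ∑ j, ∑ k, D.tri (P.q (D.b i)) (P.q (D.b j)) (D.b k) •
        (D.wedge3 (D.d i) (D.d j) (D.d k) * w) := by
    rw [← Finset.sum_add_distrib]
    refine Finset.sum_congr rfl fun i _ => ?_
    exact P.sum_split (LinearMap.mk₂ ℂ (fun x y => ∑ k, D.tri (P.q (D.b i)) x (D.b k) •
      (D.wedge3 (D.d i) y (D.d k) * w))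
      (fun a b c => by simp [tri, add_smul, Finset.sum_add_distrib])
      (fun t a b => by simp [tri, smul_smul, Finset.smul_sum])
      (fun a b c => by simp [wedge3, add_mul, mul_add, Finset.sum_add_distrib])
      (fun t a b => by simp [wedge3, smul_smul, mul_comm, Finset.smul_sum]))
  have s3 : ∑ i, ∑ j, ∑ k, D.tri (P.q (D.b i)) (P.q (D.b j)) (D.b k) •
        (D.wedge3 (D.d i) (D.d j) (D.d k) * w) =
      ∑ i, ∑ j, ∑ k, D.tri (P.q (D.b i)) (P.q (D.b j)) (D.b k) •
        (D.wedge3 (D.d i) (D.d j) (P.s' (D.d k)) * w) := by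
    refine Finset.sum_congr rfl fun i _ => Finset.sum_congr rfl fun j _ => ?_
    refine (P.sum_split (LinearMap.mk₂ ℂ (fun x y => D.tri (P.q (D.b i)) (P.q (D.b j)) x •
      (D.wedge3 (D.d i) (D.d j) y * w))
      (fun a b c => by simp [tri, add_smul])
      (fun t a b => by simp [tri, smul_smul])
      (fun a b c => by simp [wedge3, add_mul, mul_add])
      (fun t a b => by simp [wedge3, smul_smul, mul_comm]))).trans ?_
    refine add_eq_left.2 (Finset.sum_eq_zero fun k _ => ?_)
    change D.tri (P.q (D.b i)) (P.q (D.b j)) (P.q (D.b k)) •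
      (D.wedge3 (D.d i) (D.d j) (D.d k) * w) = 0
    rw [P.tri_eq_zero _ (P.q_mem _) _ (P.q_mem _) _ (P.q_mem _), zero_smul]
  have t1 := P.sum_tri_wedge3 hw LinearMap.id LinearMap.id hidN hidN hid hid
  have t2 := P.sum_tri_wedge3 hw LinearMap.id P.q hidN hqN hid hq
  have t3 := P.sum_tri_wedge3 hw P.q P.q hqN hqN hq hq
  simp only [LinearMap.id_apply] at t1 t2
  have rot : ∀ F : D.I → D.I → D.I → D.Cl,
      ∑ i, ∑ j, ∑ k, F i j k = ∑ j, ∑ k, ∑ i, F i j k := fun F =>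
    Finset.sum_comm.trans (Finset.sum_congr rfl fun _ _ => Finset.sum_comm)
  have u2 : ∑ i, ∑ j, ∑ k, D.tri (P.q (D.b i)) (D.b j) (D.b k) •
        (D.wedge3 (D.d i) (P.s' (D.d j)) (D.d k) * w) = (-2 : ℂ) • P.tauVec w := by
    rw [← t2, rot]
    refine Finset.sum_congr rfl fun j _ => Finset.sum_congr rfl fun k _ =>
      Finset.sum_congr rfl fun i _ => ?_
    rw [← D.tri_cycle, ← D.wedge3_cycle]
  have u3 : ∑ i, ∑ j, ∑ k, D.tri (P.q (D.b i)) (P.q (D.b j)) (D.b k) •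
        (D.wedge3 (D.d i) (D.d j) (P.s' (D.d k)) * w) = (-2 : ℂ) • P.tauVec w := by
    rw [← t3, rot, rot]
    refine Finset.sum_congr rfl fun k _ => Finset.sum_congr rfl fun i _ =>
      Finset.sum_congr rfl fun j _ => ?_
    rw [D.tri_cycle, D.wedge3_cycle]
  rw [cubic, smul_mul_assoc]
  simp only [Finset.sum_mul, smul_mul_assoc]
  rw [s1, s2, s3, t1, u2, u3]
  module

/-- The spin action of `x ∈ 𝔯` on a vector killed by `N`. -/
theorem nu_mul {w : D.Cl} (hw : ∀ n ∈ P.N, D.γ n * w = 0) (x : D.r)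
    (hx : ∀ y ∈ P.B, ⁅x, y⁆ ∈ P.N) :
    D.nu x * w = ((1 / 2 : ℂ) * P.tau x) • w := by
  -- For `[x, y]` or `z` in `N`, the product `γ[x, y] γ(z) w` is a multiple of `w`.
  have h1 : ∀ y, ∀ n ∈ P.N, D.wedge2 y n * w = -D.formP y n • w := by
    intro y n hn
    rw [wedge2_eq, sub_mul, mul_assoc, hw n hn, mul_zero, zero_sub,
      Algebra.algebraMap_eq_smul_one, smul_mul_assoc, one_mul, neg_smul]
  have h2 : ∀ y, ∀ n ∈ P.N, D.wedge2 n y * w = D.formP n y • w := by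
    intro y n hn
    rw [wedge2_eq, γ_anticomm, sub_mul, sub_mul, mul_assoc, hw n hn, mul_zero, sub_zero,
      Algebra.algebraMap_eq_smul_one, Algebra.algebraMap_eq_smul_one, smul_mul_assoc,
      smul_mul_assoc, one_mul]
    module
  have h3 : ∑ i, D.wedge2 ⁅x, D.b i⁆ (D.d i) * w =
      ∑ i, D.wedge2 ⁅x, D.b i⁆ (P.s' (D.d i)) * w + ∑ i, D.wedge2 ⁅x, P.q (D.b i)⁆ (D.d i) * w :=
    P.sum_split (LinearMap.mk₂ ℂ (fun y z => D.wedge2 ⁅x, y⁆ z * w)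
    (fun a b c => by simp [wedge2, add_mul]) (fun t a b => by simp [wedge2])
    (fun a b c => by simp [wedge2, mul_add, add_mul]) (fun t a b => by simp [wedge2]))
  have h4 := P.sum_split (LinearMap.mk₂ ℂ (fun y z => D.formP ⁅x, y⁆ z)
    (fun a b c => by simp) (fun t a b => by simp) (fun a b c => by simp) (fun t a b => by simp))
  simp only [LinearMap.mk₂_apply] at h4
  -- The trace of the skew endomorphism `ad x` of `𝔭` is zero.
  have h5 : ∑ i, D.formP ⁅x, D.b i⁆ (D.d i) = 0 := by
    have h := D.sum_symm (LinearMap.mk₂ ℂ (fun y z => D.formP ⁅x, y⁆ z)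
      (fun a b c => by simp) (fun t a b => by simp) (fun a b c => by simp) (fun t a b => by simp))
    simp only [LinearMap.mk₂_apply] at h
    refine self_eq_neg.1 ?_
    conv_lhs => rw [h]
    rw [← Finset.sum_neg_distrib]
    exact Finset.sum_congr rfl fun i _ => by rw [D.formP_inv, D.formP_symm]
  have h6 : P.tau x = - ∑ i, D.formP ⁅x, D.b i⁆ (P.s' (D.d i)) := by
    rw [tau_apply, ← Finset.sum_neg_distrib]
    refine Finset.sum_congr rfl fun i _ => ?_
    rw [formP_inv, neg_neg]
    rfl
  rw [h5] at h4
  rw [nu, smul_mul_assoc, Finset.sum_mul, h3]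
  have h7 : ∀ i, D.wedge2 ⁅x, D.b i⁆ (P.s' (D.d i)) * w =
      -D.formP ⁅x, D.b i⁆ (P.s' (D.d i)) • w := fun i => h1 _ _ (P.s'_mem _)
  have h8 : ∀ i, D.wedge2 ⁅x, P.q (D.b i)⁆ (D.d i) * w =
      D.formP ⁅x, P.q (D.b i)⁆ (D.d i) • w := fun i => h2 _ _ (hx _ (P.q_mem _))
  simp only [h7, h8]
  rw [← Finset.sum_smul, ← Finset.sum_smul, Finset.sum_neg_distrib]
  rw [← add_smul, smul_smul, h6]
  congr 1
  linear_combination (1 / 4 : ℂ) * h4.symm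

end Polarization

section Modules

variable {V : Type*} [AddCommGroup V] [Module ℂ V] [Module (UniversalEnvelopingAlgebra ℂ 𝔤) V]
  [IsScalarTower ℂ (UniversalEnvelopingAlgebra ℂ 𝔤) V] {L : Submodule D.Cl D.Cl}

theorem xi_tmul_tmul (a : UniversalEnvelopingAlgebra ℂ 𝔤) (c : D.Cl) (v : V) (l : L) :
    D.xi V L (a ⊗ₜ[ℂ] c) (v ⊗ₜ[ℂ] l) = (a • v) ⊗ₜ[ℂ] (c • l) := by
  simp [xi, Module.endTensorEndAlgHom_apply]

theorem xi_zeta_ι (x : D.r) (v : V) (l : L) :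
    D.xi V L (D.zeta (UniversalEnvelopingAlgebra.ι ℂ x)) (v ⊗ₜ[ℂ] l) =
      (UniversalEnvelopingAlgebra.ι ℂ (x : 𝔤) • v) ⊗ₜ[ℂ] l + v ⊗ₜ[ℂ] (D.nu x • l) := by
  have h : D.zeta (UniversalEnvelopingAlgebra.ι ℂ x) =
      UniversalEnvelopingAlgebra.ι ℂ (x : 𝔤) ⊗ₜ[ℂ] 1 + 1 ⊗ₜ[ℂ] D.nu x := by
    rw [zeta, UniversalEnvelopingAlgebra.lift_ι_apply]
    rfl
  rw [h, map_add, LinearMap.add_apply, xi_tmul_tmul, xi_tmul_tmul, one_smul, one_smul]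

/-- The Dirac operator kills `v ⊗ l` if `l` is killed by `N` and `v` is an eigenvector of `B` with
the eigenvalue `-τ/2`. -/
theorem Polarization.diracOp_tmul {D : QuadraticPair 𝔤} {L : Submodule D.Cl D.Cl}
    (P : D.Polarization) {v : V} {l : L} (hl : ∀ n ∈ P.N, D.γ n * (l : D.Cl) = 0)
    (hv : ∀ y ∈ P.B, UniversalEnvelopingAlgebra.ι ℂ (y : 𝔤) • v =
      (-(1 / 2 : ℂ) * P.tau y) • v) : D.diracOp V L (v ⊗ₜ[ℂ] l) = 0 := by
  have h1 : D.diracOp V L (v ⊗ₜ[ℂ] l) =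
      ∑ i, (UniversalEnvelopingAlgebra.ι ℂ (D.b i : 𝔤) • v) ⊗ₜ[ℂ] (D.γ (D.d i) • l) +
        v ⊗ₜ[ℂ] (D.cubic • l) := by
    rw [diracOp, dirac, map_add, map_sum, LinearMap.add_apply, LinearMap.sum_apply]
    simp only [xi_tmul_tmul, one_smul]
  have h2 := P.sum_split (LinearMap.mk₂ ℂ (fun x y : D.p =>
      (UniversalEnvelopingAlgebra.ι ℂ (x : 𝔤) • v) ⊗ₜ[ℂ] (D.γ y • l))
    (fun a b c => by simp [add_smul, TensorProduct.add_tmul])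
    (fun t a b => by simp [TensorProduct.smul_tmul'])
    (fun a b c => by simp [add_smul, TensorProduct.tmul_add])
    (fun t a b => by
      rw [map_smul, smul_assoc]
      exact TensorProduct.tmul_smul (R := ℂ) t (UniversalEnvelopingAlgebra.ι ℂ (a : 𝔤) • v)
        (D.γ b • l)))
  simp only [LinearMap.mk₂_apply] at h2
  have h3 : ∀ n ∈ P.N, D.γ n • l = 0 := fun n hn => Subtype.ext (hl n hn)
  have h4 : ∀ i, (UniversalEnvelopingAlgebra.ι ℂ (D.b i : 𝔤) • v) ⊗ₜ[ℂ] (D.γ (P.s' (D.d i)) • l) =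
      0 := fun i => by rw [h3 _ (P.s'_mem _), TensorProduct.tmul_zero]
  have h5 : ∀ i, (UniversalEnvelopingAlgebra.ι ℂ (P.q (D.b i) : 𝔤) • v) ⊗ₜ[ℂ] (D.γ (D.d i) • l) =
      v ⊗ₜ[ℂ] ((-(1 / 2 : ℂ) * P.tau (P.q (D.b i))) • (D.γ (D.d i) • l)) := fun i => by
    rw [hv _ (P.q_mem _), TensorProduct.smul_tmul]
  simp only [h4, h5, Finset.sum_const_zero, zero_add] at h2
  rw [h1, h2, ← TensorProduct.tmul_sum, ← TensorProduct.tmul_add]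
  convert TensorProduct.tmul_zero L v using 2
  refine Subtype.ext ?_
  have h6 := P.sum_q_smul hl P.tauP
  have h7 := P.cubic_mul hl
  rw [tauVec, ← h6] at h7
  rw [Submodule.coe_add, Submodule.coe_sum]
  change _ + D.cubic * (l : D.Cl) = 0
  rw [h7, Finset.smul_sum, ← Finset.sum_add_distrib]
  refine Finset.sum_eq_zero fun i _ => ?_
  change (-(1 / 2 : ℂ) * P.tau (P.q (D.b i))) • (D.γ (D.d i) * (l : D.Cl)) +
    (1 / 2 : ℂ) • P.tau (P.q (D.b i)) • (D.γ (D.d i) * (l : D.Cl)) = 0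
  module

end Modules

end QuadraticPair

namespace QuadraticPair

variable {𝔤 : Type*} [LieRing 𝔤] [LieAlgebra ℂ 𝔤] [FiniteDimensional ℂ 𝔤]

/-! ### The orthogonal projection to `𝔭` -/

section Projection

variable (D : QuadraticPair 𝔤)

theorem form_comm (x y : 𝔤) : D.form x y = D.form y x := D.form_symm.eq _ _

theorem mem_p_iff {y : 𝔤} : y ∈ D.p ↔ ∀ x ∈ D.r, D.form x y = 0 := Iff.rfl

theorem mem_r_iff {x : 𝔤} : x ∈ D.r ↔ ∀ y ∈ D.p, D.form y x = 0 := by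
  refine ⟨fun hx y hy => by rw [form_comm]; exact hy x hx, fun h => ?_⟩
  have h1 := LinearMap.BilinForm.orthogonal_orthogonal D.form_nondeg D.form_symm.isRefl
    D.r.toSubmodule
  change x ∈ D.r.toSubmodule
  rw [← h1]
  exact fun y hy => h y hy

theorem eq_zero_of_mem_of_mem {x : 𝔤} (hr : x ∈ D.r) (hp : x ∈ D.p) : x = 0 := by
  have h := LinearMap.BilinForm.Nondegenerate.ker_eq_bot D.form_r_nondeg
  have h1 : (⟨x, hr⟩ : D.r.toSubmodule) ∈ LinearMap.ker (D.form.restrict D.r.toSubmodule) := by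
    refine LinearMap.mem_ker.2 (LinearMap.ext fun y => ?_)
    change D.form x y = 0
    rw [form_comm]
    exact hp y y.2
  rw [h, Submodule.mem_bot] at h1
  exact congrArg Subtype.val h1

theorem lie_mem_p {x y : 𝔤} (hx : x ∈ D.r) (hy : y ∈ D.p) : ⁅x, y⁆ ∈ D.p :=
  D.p.lie_mem (x := ⟨x, hx⟩) hy

/-- The projection `𝔤 → 𝔭` along `𝔯`, with values in `𝔤`. -/
def projP : Module.End ℂ 𝔤 := ∑ i, (D.form (D.b i : 𝔤)).smulRight (D.d i : 𝔤)

theorem projP_apply (z : 𝔤) : D.projP z = ∑ i, D.form (D.b i : 𝔤) z • (D.d i : 𝔤) := by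
  simp [projP]

theorem projP_mem (z : 𝔤) : D.projP z ∈ D.p := by
  rw [projP_apply]
  exact Submodule.sum_mem D.p.toSubmodule fun i _ => D.p.toSubmodule.smul_mem _ (D.d i).2

theorem projP_of_mem {z : 𝔤} (hz : z ∈ D.p) : D.projP z = z := by
  have h := congrArg (D.p.toSubmodule.subtype) (D.sum_d ⟨z, hz⟩)
  rw [map_sum] at h
  rw [projP_apply]
  exact h

theorem projP_of_mem_r {z : 𝔤} (hz : z ∈ D.r) : D.projP z = 0 := by
  rw [projP_apply]
  exact Finset.sum_eq_zero fun i _ => by rw [D.mem_r_iff.1 hz _ (D.b i).2, zero_smul]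

theorem sub_projP_mem (z : 𝔤) : z - D.projP z ∈ D.r := by
  refine D.mem_r_iff.2 fun y hy => ?_
  have h := congrArg (fun t : D.p => D.form (t : 𝔤) z) (D.sum_b ⟨y, hy⟩)
  simp only at h
  rw [map_sub, projP_apply, ← h, sub_eq_zero]
  change (D.form.flip z) (D.p.toSubmodule.subtype _) = _
  rw [map_sum, map_sum, map_sum]
  refine Finset.sum_congr rfl fun i _ => ?_
  rw [map_smul, map_smul, map_smul, smul_eq_mul, smul_eq_mul, mul_comm, D.form_comm y]
  rfl

/-- The projection `𝔤 → 𝔯` along `𝔭`, with values in `𝔤`. -/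
def projR : Module.End ℂ 𝔤 := LinearMap.id - D.projP

theorem projR_apply (z : 𝔤) : D.projR z = z - D.projP z := rfl

theorem projR_mem (z : 𝔤) : D.projR z ∈ D.r := D.sub_projP_mem z

theorem projR_of_mem {z : 𝔤} (hz : z ∈ D.r) : D.projR z = z := by
  rw [projR_apply, projP_of_mem_r D hz, sub_zero]

theorem projR_of_mem_p {z : 𝔤} (hz : z ∈ D.p) : D.projR z = 0 := by
  rw [projR_apply, projP_of_mem D hz, sub_self]

theorem projP_lie {x : 𝔤} (hx : x ∈ D.r) (z : 𝔤) : D.projP ⁅x, z⁆ = ⁅x, D.projP z⁆ := by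
  have h : z = D.projR z + D.projP z := by rw [projR_apply, sub_add_cancel]
  conv_lhs => rw [h]
  rw [lie_add, map_add, D.projP_of_mem_r (D.r.lie_mem hx (D.projR_mem z)),
    D.projP_of_mem (D.lie_mem_p hx (D.projP_mem z)), zero_add]

theorem projR_lie {x : 𝔤} (hx : x ∈ D.r) (z : 𝔤) : D.projR ⁅x, z⁆ = ⁅x, D.projR z⁆ := by
  rw [projR_apply, projR_apply, projP_lie D hx, lie_sub]

/-- For `y ∈ 𝔭`, the operator `ad y` maps `𝔯` to `𝔭`. -/
theorem lie_mem_p_of_mem {y x : 𝔤} (hy : y ∈ D.p) (hx : x ∈ D.r) : ⁅y, x⁆ ∈ D.p := by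
  rw [← lie_skew]
  exact D.p.toSubmodule.neg_mem (D.lie_mem_p hx hy)

end Projection

namespace CartanData

variable [LieAlgebra.IsSemisimple ℂ 𝔤] {D : QuadraticPair 𝔤} (T : D.CartanData)

/-! ### The root space decomposition -/

/-- The weights of `𝔥` in `𝔤`: the roots and, if `𝔥 ≠ 0`, zero. -/
abbrev Wt : Type _ := LieModule.Weight ℂ T.h 𝔤

/-- The root space of a weight, as a subspace of `𝔤`. -/
abbrev rootSub (α : T.Wt) : Submodule ℂ 𝔤 := (LieAlgebra.rootSpace T.h α).toSubmodule

theorem iSup_rootSub : ⨆ α, T.rootSub α = ⊤ := by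
  rw [← LieSubmodule.iSup_toSubmodule, LieModule.iSup_genWeightSpace_eq_top' ℂ T.h 𝔤]
  rfl

open scoped Classical in
theorem isInternal_rootSub : DirectSum.IsInternal T.rootSub :=
  DirectSum.isInternal_submodule_of_iSupIndep_of_iSup_eq_top
    (LieSubmodule.iSupIndep_toSubmodule.2 (LieModule.iSupIndep_genWeightSpace' ℂ T.h 𝔤))
    T.iSup_rootSub

open scoped Classical in
/-- The root space decomposition of `𝔤`. -/
def rootEquiv : (DirectSum T.Wt fun α => T.rootSub α) ≃ₗ[ℂ] 𝔤 :=
  LinearEquiv.ofBijective (DirectSum.coeLinearMap T.rootSub) T.isInternal_rootSub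

/-- The projection of `𝔤` to the root space of `α`, with values in `𝔤`. -/
def comp (α : T.Wt) : Module.End ℂ 𝔤 :=
  (T.rootSub α).subtype ∘ₗ DirectSum.component ℂ T.Wt (fun α => T.rootSub α) α ∘ₗ
    T.rootEquiv.symm.toLinearMap

theorem comp_mem (α : T.Wt) (z : 𝔤) : T.comp α z ∈ LieAlgebra.rootSpace T.h α :=
  Subtype.prop (DirectSum.component ℂ T.Wt (fun α => T.rootSub α) α (T.rootEquiv.symm z))

open scoped Classical in
theorem comp_of_mem {α : T.Wt} {z : 𝔤} (hz : z ∈ LieAlgebra.rootSpace T.h α) (β : T.Wt) :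
    T.comp β z = if β = α then z else 0 := by
  have h : T.rootEquiv.symm z = DirectSum.lof ℂ T.Wt (fun α => T.rootSub α) α ⟨z, hz⟩ := by
    rw [LinearEquiv.symm_apply_eq]
    exact (DirectSum.coeLinearMap_lof T.rootSub α ⟨z, hz⟩).symm
  rw [comp, LinearMap.comp_apply, LinearMap.comp_apply, LinearEquiv.coe_coe, h]
  split_ifs with hαβ
  · subst hαβ
    rw [DirectSum.component.lof_self]
    rfl
  · rw [DirectSum.component.of, dif_neg (Ne.symm hαβ), map_zero]

theorem sum_comp (z : 𝔤) : ∑ α, T.comp α z = z := by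
  have hz : z ∈ ⨆ α, T.rootSub α := T.iSup_rootSub ▸ Submodule.mem_top
  have hle : ⨆ α, T.rootSub α ≤ LinearMap.eqLocus (∑ α, T.comp α) LinearMap.id := by
    refine iSup_le fun α y hy => ?_
    rw [LinearMap.mem_eqLocus, LinearMap.sum_apply, LinearMap.id_apply,
      Finset.sum_eq_single α, T.comp_of_mem hy, if_pos rfl]
    · intro β _ hβ
      rw [T.comp_of_mem hy, if_neg hβ]
    · intro h
      exact absurd (Finset.mem_univ α) h
  have := hle hz
  rwa [LinearMap.mem_eqLocus, LinearMap.sum_apply] at this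

theorem comp_self (α : T.Wt) (z : 𝔤) : T.comp α (T.comp α z) = T.comp α z := by
  rw [T.comp_of_mem (T.comp_mem α z), if_pos rfl]

theorem comp_ne {α β : T.Wt} (h : α ≠ β) (z : 𝔤) : T.comp α (T.comp β z) = 0 := by
  rw [T.comp_of_mem (T.comp_mem β z), if_neg h]

theorem ext_comp {y z : 𝔤} (h : ∀ α, T.comp α y = T.comp α z) : y = z := by
  rw [← T.sum_comp y, ← T.sum_comp z]
  exact Finset.sum_congr rfl fun α _ => h α

theorem lie_comp (x : T.h) (α : T.Wt) (z : 𝔤) : ⁅(x : 𝔤), T.comp α z⁆ = α x • T.comp α z :=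
  LieAlgebra.IsKilling.lie_eq_smul_of_mem_rootSpace (T.comp_mem α z) x

theorem comp_lie (x : T.h) (α : T.Wt) (z : 𝔤) : T.comp α ⁅(x : 𝔤), z⁆ = α x • T.comp α z := by
  conv_lhs => rw [← T.sum_comp z, lie_sum]
  simp only [T.lie_comp, map_sum, map_smul]
  rw [Finset.sum_eq_single α, comp_self]
  · intro β _ hβ
    rw [T.comp_ne hβ.symm, smul_zero]
  · intro h
    exact absurd (Finset.mem_univ α) h

theorem mem_h_iff {z : 𝔤} : z ∈ T.h ↔ ∀ α : T.Wt, α.IsNonZero → T.comp α z = 0 := by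
  have h0 : ∀ z, z ∈ LieAlgebra.rootSpace T.h (0 : T.h → ℂ) ↔ z ∈ T.h := fun z => by
    rw [LieAlgebra.rootSpace_zero_eq ℂ 𝔤 T.h]
    exact LieSubalgebra.mem_toLieSubmodule z
  constructor
  · intro hz α hα
    obtain ⟨x, hx⟩ : ∃ x, α x ≠ 0 := by
      by_contra! hcon
      exact hα (funext hcon)
    have h := T.comp_lie x α z
    have h1 : ⁅(x : 𝔤), z⁆ = 0 := by
      have := LieSubalgebra.coe_bracket T.h x ⟨z, hz⟩
      rw [trivial_lie_zero] at this
      exact this.symm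
    rw [h1, map_zero] at h
    exact (smul_eq_zero.1 h.symm).resolve_left hx
  · intro h
    rw [← T.sum_comp z]
    refine Submodule.sum_mem T.h.toSubmodule fun α _ => ?_
    by_cases hα : α.IsZero
    · have := T.comp_mem α z
      rw [show (α : T.h → ℂ) = 0 from hα] at this
      exact (h0 _).1 this
    · rw [h α hα]
      exact T.h.zero_mem

/-- The linear combination `∑ φ(α) comp α` of the projections to the root spaces. -/
def diag (φ : T.Wt → ℂ) : Module.End ℂ 𝔤 := ∑ α, φ α • T.comp α

theorem diag_apply (φ : T.Wt → ℂ) (z : 𝔤) : T.diag φ z = ∑ α, φ α • T.comp α z := by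
  simp [diag]

theorem comp_diag (φ : T.Wt → ℂ) (α : T.Wt) (z : 𝔤) :
    T.comp α (T.diag φ z) = φ α • T.comp α z := by
  rw [diag_apply, map_sum, Finset.sum_eq_single α, map_smul, comp_self]
  · intro β _ hβ
    rw [map_smul, T.comp_ne hβ.symm, smul_zero]
  · intro h
    exact absurd (Finset.mem_univ α) h

/-- An operator commuting with `ad s`, `s ∈ 𝔥`, commutes with every function of `ad s`. -/
theorem commute_diag {s : T.h} {S : Module.End ℂ 𝔤} (hS : ∀ z, S ⁅(s : 𝔤), z⁆ = ⁅(s : 𝔤), S z⁆)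
    {φ : T.Wt → ℂ} (hφ : ∀ α β, α s = β s → φ α = φ β) (z : 𝔤) :
    S (T.diag φ z) = T.diag φ (S z) := by
  have h : ∀ β, T.diag φ (S (T.comp β z)) = φ β • S (T.comp β z) := by
    intro β
    refine T.ext_comp fun α => ?_
    rw [comp_diag, map_smul]
    have h1 : α s • T.comp α (S (T.comp β z)) = β s • T.comp α (S (T.comp β z)) := by
      rw [← T.comp_lie, ← hS, T.lie_comp, map_smul, map_smul]
    by_cases hαβ : α s = β s
    · rw [hφ α β hαβ]
    · rw [← sub_eq_zero, ← sub_smul] at h1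
      rw [(smul_eq_zero.1 h1).resolve_left (sub_ne_zero.2 hαβ), smul_zero, smul_zero]
  conv_rhs => rw [← T.sum_comp z, map_sum, map_sum]
  rw [diag_apply, map_sum]
  exact Finset.sum_congr rfl fun β _ => by rw [h, map_smul]

/-! ### Positive, zero and negative parts -/

/-- The indicator function of a set of complex numbers, with complex values. -/
def ind (σ : Set ℂ) : ℂ → ℂ := σ.indicator 1

/-- The projection of `𝔤` to the sum of the root spaces of the `α` with `Re α(s) > 0`. -/
def pos (s : T.h) : Module.End ℂ 𝔤 := T.diag fun α => ind {c | 0 < c.re} (α s)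

/-- The projection of `𝔤` to the sum of the root spaces of the `α` with `Re α(s) = 0`. -/
def zer (s : T.h) : Module.End ℂ 𝔤 := T.diag fun α => ind {c | c.re = 0} (α s)

/-- The projection of `𝔤` to the sum of the root spaces of the `α` with `Re α(s) < 0`. -/
def neg (s : T.h) : Module.End ℂ 𝔤 := T.diag fun α => ind {c | c.re < 0} (α s)

open scoped Classical in
theorem ind_apply (σ : Set ℂ) (c : ℂ) : ind σ c = if c ∈ σ then 1 else 0 := by
  simp [ind, Set.indicator_apply]

open scoped Classical in
theorem comp_pos (s : T.h) (α : T.Wt) (z : 𝔤) :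
    T.comp α (T.pos s z) = if 0 < (α s).re then T.comp α z else 0 := by
  rw [pos, comp_diag, ind_apply, ite_smul, one_smul, zero_smul]
  rfl

open scoped Classical in
theorem comp_zer (s : T.h) (α : T.Wt) (z : 𝔤) :
    T.comp α (T.zer s z) = if (α s).re = 0 then T.comp α z else 0 := by
  rw [zer, comp_diag, ind_apply, ite_smul, one_smul, zero_smul]
  rfl

open scoped Classical in
theorem comp_neg (s : T.h) (α : T.Wt) (z : 𝔤) :
    T.comp α (T.neg s z) = if (α s).re < 0 then T.comp α z else 0 := by
  rw [neg, comp_diag, ind_apply, ite_smul, one_smul, zero_smul]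
  rfl

theorem pos_add_zer_add_neg (s : T.h) (z : 𝔤) : T.pos s z + T.zer s z + T.neg s z = z := by
  refine T.ext_comp fun α => ?_
  rw [map_add, map_add, comp_pos, comp_zer, comp_neg]
  rcases lt_trichotomy (α s).re 0 with h | h | h
  · simp [h, h.ne, h.not_gt]
  · simp [h]
  · simp [h, h.ne', h.not_gt]

theorem posPart_toSubmodule (s : T.h) : (T.posPart s).toSubmodule =
    ⨆ (α : T.Wt) (_ : 0 < (α s).re), (LieAlgebra.rootSpace T.h α).toSubmodule := by
  simp only [posPart, LieSubmodule.iSup_toSubmodule]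

theorem mem_posPart_iff {s : T.h} {z : 𝔤} :
    z ∈ T.posPart s ↔ ∀ α : T.Wt, ¬ 0 < (α s).re → T.comp α z = 0 := by
  rw [← LieSubmodule.mem_toSubmodule, posPart_toSubmodule]
  constructor
  · intro hz
    have h : (⨆ (α : T.Wt) (_ : 0 < (α s).re), (LieAlgebra.rootSpace T.h α).toSubmodule) ≤
        ⨅ (α : T.Wt) (_ : ¬ 0 < (α s).re), LinearMap.ker (T.comp α) := by
      refine iSup₂_le fun α hα => le_iInf₂ fun β hβ z hz => ?_
      rw [LinearMap.mem_ker, T.comp_of_mem hz, if_neg]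
      rintro rfl
      exact hβ hα
    have := h hz
    simp only [Submodule.mem_iInf, LinearMap.mem_ker] at this
    exact this
  · intro h
    rw [← T.sum_comp z]
    refine Submodule.sum_mem _ fun α _ => ?_
    by_cases hα : 0 < (α s).re
    · exact Submodule.mem_iSup_of_mem α (Submodule.mem_iSup_of_mem hα (T.comp_mem α z))
    · rw [h α hα]
      exact Submodule.zero_mem _

theorem pos_mem (s : T.h) (z : 𝔤) : T.pos s z ∈ T.posPart s :=
  T.mem_posPart_iff.2 fun α hα => by rw [comp_pos, if_neg hα]

theorem pos_eq_self {s : T.h} {z : 𝔤} (hz : z ∈ T.posPart s) : T.pos s z = z := by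
  refine T.ext_comp fun α => ?_
  rw [comp_pos]
  split_ifs with h
  · rfl
  · exact (T.mem_posPart_iff.1 hz α h).symm

theorem neg_eq_zero {s : T.h} {z : 𝔤} (hz : z ∈ T.posPart s) : T.neg s z = 0 := by
  refine T.ext_comp fun α => ?_
  rw [comp_neg, map_zero]
  split_ifs with h
  · exact T.mem_posPart_iff.1 hz α h.not_gt
  · rfl

/-- Eigenvectors of `ad s` for an eigenvalue with positive real part. -/
theorem mem_posPart_of_lie {s : T.h} {z : 𝔤} {c : ℂ} (hc : 0 < c.re) (hz : ⁅(s : 𝔤), z⁆ = c • z) :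
    z ∈ T.posPart s := by
  refine T.mem_posPart_iff.2 fun α hα => ?_
  have h := T.comp_lie s α z
  rw [hz, map_smul, ← sub_eq_zero, ← sub_smul] at h
  refine (smul_eq_zero.1 h).resolve_left fun h0 => hα ?_
  rw [← sub_eq_zero.1 h0]
  exact hc

theorem pos_of_mem_h {s : T.h} {z : 𝔤} (hz : z ∈ T.h) : T.pos s z = 0 := by
  refine T.ext_comp fun α => ?_
  rw [comp_pos, map_zero]
  split_ifs with h
  · refine T.mem_h_iff.1 hz α fun h0 => ?_
    rw [show (α : T.h → ℂ) = 0 from h0] at h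
    simp at h
  · rfl

theorem neg_of_mem_h {s : T.h} {z : 𝔤} (hz : z ∈ T.h) : T.neg s z = 0 := by
  refine T.ext_comp fun α => ?_
  rw [comp_neg, map_zero]
  split_ifs with h
  · refine T.mem_h_iff.1 hz α fun h0 => ?_
    rw [show (α : T.h → ℂ) = 0 from h0] at h
    simp at h
  · rfl

theorem zer_f_mem (z : 𝔤) : T.zer T.f z ∈ T.h := by
  refine T.mem_h_iff.2 fun α hα => ?_
  rw [comp_zer, if_neg]
  intro h
  exact T.f_regular α hα (Complex.ext h (T.f_hyperbolic α))

theorem pos_lie (s x : T.h) (z : 𝔤) : T.pos s ⁅(x : 𝔤), z⁆ = ⁅(x : 𝔤), T.pos s z⁆ := by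
  refine T.ext_comp fun α => ?_
  rw [comp_pos, comp_lie, comp_lie, comp_pos, smul_ite, smul_zero]

theorem lie_mem_posPart {s : T.h} {y z : 𝔤} (hy : y ∈ T.posPart s) (hz : z ∈ T.posPart s) :
    ⁅y, z⁆ ∈ T.posPart s := by
  rw [← T.pos_eq_self hy, ← T.pos_eq_self hz, ← T.sum_comp (T.pos s y), ← T.sum_comp (T.pos s z),
    sum_lie]
  refine Submodule.sum_mem (T.posPart s).toSubmodule fun α _ => ?_
  rw [lie_sum]
  refine Submodule.sum_mem (T.posPart s).toSubmodule fun β _ => ?_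
  rw [comp_pos, comp_pos]
  split_ifs with h1 h2
  · refine T.mem_posPart_of_lie (c := α s + β s) (by rw [Complex.add_re]; linarith) ?_
    rw [leibniz_lie, lie_comp, lie_comp, smul_lie, lie_smul, add_smul]
  all_goals simp

/-! ### The form and the root space decomposition -/

theorem form_comp {α β : T.Wt} {x : T.h} (h : α x + β x ≠ 0) (y z : 𝔤) :
    D.form (T.comp α y) (T.comp β z) = 0 := by
  have h1 := D.form_inv (x : 𝔤) (T.comp α y) (T.comp β z)
  rw [lie_comp, lie_comp, map_smul, map_smul, LinearMap.smul_apply, smul_eq_mul, smul_eq_mul] at h1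
  have h2 : (α x + β x) * D.form (T.comp α y) (T.comp β z) = 0 := by
    rw [add_mul, h1]
    ring
  exact (mul_eq_zero.1 h2).resolve_left h

theorem form_diag {φ ψ : T.Wt → ℂ} {s : T.h} (h : ∀ α β, α s + β s = 0 → φ α = ψ β) (y z : 𝔤) :
    D.form (T.diag φ y) z = D.form y (T.diag ψ z) := by
  conv_lhs => rw [← T.sum_comp z]
  conv_rhs => rw [← T.sum_comp y]
  rw [diag_apply, diag_apply]
  simp only [map_sum, LinearMap.sum_apply, map_smul, LinearMap.smul_apply, Finset.smul_sum]
  refine Finset.sum_congr rfl fun β _ => Finset.sum_congr rfl fun α _ => ?_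
  by_cases hαβ : α s + β s = 0
  · rw [h _ _ hαβ]
  · rw [T.form_comp hαβ, smul_zero, smul_zero]

theorem form_neg (s : T.h) (y z : 𝔤) : D.form (T.neg s y) z = D.form y (T.pos s z) := by
  refine T.form_diag (s := s) (fun α β h => ?_) y z
  rw [ind_apply, ind_apply, ← neg_eq_iff_add_eq_zero.2 h]
  simp

theorem form_zer (s : T.h) (y z : 𝔤) : D.form (T.zer s y) z = D.form y (T.zer s z) := by
  refine T.form_diag (s := s) (fun α β h => ?_) y z
  rw [ind_apply, ind_apply, ← neg_eq_iff_add_eq_zero.2 h]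
  simp

/-! ### Compatibility of the positive system with `𝔤 = 𝔯 + 𝔭` -/

/-- There is an element of `𝔥_𝔯` with the image `f_𝔯` under `κ`: its eigenvalues have the real parts
`α(f_𝔯)`. It serves as a substitute for `f_𝔯`, which need not lie in `𝔯`. -/
theorem exists_hr_re : ∃ t : T.h, (t : 𝔤) ∈ D.r ∧ ∀ α : T.Wt, (α t).re = (α T.fr).re := by
  obtain ⟨z, hz, hmem⟩ := T.fr_mem
  refine ⟨_, hmem, fun α => ?_⟩
  have h : α (T.fr + Complex.I • z) = α T.fr + Complex.I * α z := by
    change LieModule.Weight.toLinear ℂ T.h 𝔤 α _ = _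
    rw [map_add, map_smul]
    rfl
  rw [h, Complex.add_re, Complex.mul_re, hz α]
  simp

/-- An element of `𝔥_𝔯` over `f_𝔯`. -/
def t₀ : T.h := T.exists_hr_re.choose

theorem t₀_mem : (T.t₀ : 𝔤) ∈ D.r := T.exists_hr_re.choose_spec.1

theorem t₀_re (α : T.Wt) : (α T.t₀).re = (α T.fr).re := T.exists_hr_re.choose_spec.2 α

theorem pos_fr_eq : T.pos T.fr = T.pos T.t₀ := by
  unfold pos
  congr 1
  funext α
  rw [ind_apply, ind_apply, Set.mem_ofPred_eq, Set.mem_ofPred_eq, t₀_re]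

theorem zer_fr_eq : T.zer T.fr = T.zer T.t₀ := by
  unfold zer
  congr 1
  funext α
  rw [ind_apply, ind_apply, Set.mem_ofPred_eq, Set.mem_ofPred_eq, t₀_re]

theorem projP_pos_fr (z : 𝔤) : D.projP (T.pos T.fr z) = T.pos T.fr (D.projP z) := by
  rw [pos_fr_eq]
  exact T.commute_diag (D.projP_lie T.t₀_mem) (fun α β h => by rw [h]) z

theorem projP_zer_fr (z : 𝔤) : D.projP (T.zer T.fr z) = T.zer T.fr (D.projP z) := by
  rw [zer_fr_eq]
  exact T.commute_diag (D.projP_lie T.t₀_mem) (fun α β h => by rw [h]) z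

theorem projR_pos_fr (z : 𝔤) : D.projR (T.pos T.fr z) = T.pos T.fr (D.projR z) := by
  rw [projR_apply, projR_apply, map_sub, projP_pos_fr]

theorem projR_zer_fr (z : 𝔤) : D.projR (T.zer T.fr z) = T.zer T.fr (D.projR z) := by
  rw [projR_apply, projR_apply, map_sub, projP_zer_fr]

theorem lie_zer_fr {t : 𝔤} (ht : t ∈ T.h) (htr : t ∈ D.r) (z : 𝔤) : ⁅t, T.zer T.fr z⁆ = 0 := by
  refine (T.fr_centralizer _).1 (T.ext_comp fun α => ?_) t ht htr
  rw [comp_lie, comp_zer, map_zero]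
  split_ifs with h
  · rw [show α T.fr = 0 from Complex.ext h (T.fr_hyperbolic α), zero_smul]
  · rw [smul_zero]

/-- The centralizer of `𝔥_𝔯` in `𝔯` is `𝔥_𝔯`. -/
theorem mem_h_of_centralizes {y : 𝔤} (hy : y ∈ D.r) (h : ∀ t ∈ T.h, t ∈ D.r → ⁅t, y⁆ = 0) :
    y ∈ T.h := by
  have h1 : (⟨y, hy⟩ : D.r) ∈ T.hr.normalizer := by
    refine (LieSubalgebra.mem_normalizer_iff' _ _).2 fun t ht => ?_
    have h2 : ⁅t, (⟨y, hy⟩ : D.r)⁆ = 0 := Subtype.ext (h t ht t.2)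
    rw [h2]
    exact T.hr.zero_mem
  rw [T.cartan_r.self_normalizing] at h1
  exact h1

theorem lie_eq_zero_of_mem_h {x y : 𝔤} (hx : x ∈ T.h) (hy : y ∈ T.h) : ⁅x, y⁆ = 0 := by
  have := LieSubalgebra.coe_bracket T.h ⟨x, hx⟩ ⟨y, hy⟩
  rw [trivial_lie_zero] at this
  exact this.symm

theorem zer_fr_mem_h {y : 𝔤} (hy : y ∈ D.r) : T.zer T.fr y ∈ T.h := by
  refine T.mem_h_of_centralizes ?_ fun t ht htr => T.lie_zer_fr ht htr y
  rw [← D.projR_of_mem hy, ← projR_zer_fr]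
  exact D.projR_mem _

/-- A weight which is positive at `f` is nonnegative at `f_𝔯`; applied to the negative of a root,
this yields that a root which is positive at `f_𝔯` is positive at `f`. -/
theorem pos_f_of_pos_fr {α : T.Wt} (h : 0 < (α T.fr).re) : 0 < (α T.f).re := by
  have hα : α.IsNonZero := by
    intro h0
    rw [show (α : T.h → ℂ) = 0 from h0] at h
    simp at h
  rcases lt_trichotomy (α T.f).re 0 with h1 | h1 | h1
  · have h2 := T.f_chamber (-α) (by
      rw [LieModule.Weight.coe_neg, Pi.neg_apply, Complex.neg_re]
      linarith)
    rw [LieModule.Weight.coe_neg, Pi.neg_apply, Complex.neg_re] at h2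
    linarith
  · exact absurd (Complex.ext h1 (T.f_hyperbolic α)) (T.f_regular α hα)
  · exact h1

theorem posPart_fr_le {z : 𝔤} (hz : z ∈ T.nilradQ) : z ∈ T.n :=
  T.mem_posPart_iff.2 fun α hα => T.mem_posPart_iff.1 hz α fun h => hα (T.pos_f_of_pos_fr h)

theorem pos_f_pos_fr (z : 𝔤) : T.pos T.f (T.pos T.fr z) = T.pos T.fr z :=
  T.pos_eq_self (T.posPart_fr_le (T.pos_mem _ z))

theorem pos_f_neg_fr (z : 𝔤) : T.pos T.f (T.neg T.fr z) = 0 := by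
  refine T.ext_comp fun α => ?_
  rw [comp_pos, comp_neg, map_zero]
  split_ifs with h1 h2
  · exact absurd (T.f_chamber α h1) h2.not_ge
  · rfl
  · rfl

theorem pos_f_zer_fr (z : 𝔤) : T.pos T.f (T.zer T.fr z) = T.zer T.fr (T.pos T.f z) := by
  refine T.ext_comp fun α => ?_
  rw [comp_pos, comp_zer, comp_zer, comp_pos]
  split_ifs <;> rfl

theorem pos_f_eq (z : 𝔤) : T.pos T.f z = T.pos T.fr z + T.zer T.fr (T.pos T.f z) := by
  conv_lhs => rw [← T.pos_add_zer_add_neg T.fr z]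
  rw [map_add, map_add, pos_f_pos_fr, pos_f_neg_fr, add_zero, pos_f_zer_fr]

/-- On `𝔯`, the projection to `𝔫` agrees with the one to the nilradical of `𝔮`. -/
theorem pos_f_of_mem_r {y : 𝔤} (hy : y ∈ D.r) : T.pos T.f y = T.pos T.fr y := by
  rw [pos_f_eq, ← pos_f_zer_fr, T.pos_of_mem_h (T.zer_fr_mem_h hy), add_zero]

/-- The part of `𝔫` centralized by `𝔥_𝔯` lies in `𝔭`. -/
theorem projR_zer_fr_pos_f (z : 𝔤) : D.projR (T.zer T.fr (T.pos T.f z)) = 0 := by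
  set t := D.projR (T.zer T.fr (T.pos T.f z)) with ht
  -- `t` lies in `𝔥_𝔯` and is orthogonal to `𝔯`, because `𝔥` is orthogonal to `𝔫`.
  refine D.eq_zero_of_mem_of_mem (D.projR_mem _) (D.mem_p_iff.2 fun y hy => ?_)
  have h1 : T.zer T.fr (T.pos T.f z) = t + D.projP (T.zer T.fr (T.pos T.f z)) := by
    rw [ht, projR_apply, sub_add_cancel]
  have h2 : D.form y t = D.form y (T.zer T.fr (T.pos T.f z)) := by
    rw [h1, map_add, D.projP_mem _ y hy, add_zero]
  rw [h2, ← form_zer, ← form_neg, T.neg_of_mem_h (T.zer_fr_mem_h hy), map_zero,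
    LinearMap.zero_apply]

/-- The projection to `𝔫` respects the decomposition `𝔤 = 𝔯 + 𝔭`. -/
theorem projR_pos_f (z : 𝔤) : D.projR (T.pos T.f z) = T.pos T.f (D.projR z) := by
  rw [T.pos_f_of_mem_r (D.projR_mem z), pos_f_eq, map_add, projR_zer_fr_pos_f, add_zero,
    projR_pos_fr]

theorem projP_pos_f (z : 𝔤) : D.projP (T.pos T.f z) = T.pos T.f (D.projP z) := by
  have h := T.projR_pos_f z
  rw [projR_apply, projR_apply, map_sub] at h
  exact sub_right_injective h

theorem pos_f_mem_p {y : 𝔤} (hy : y ∈ D.p) : T.pos T.f y ∈ D.p := by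
  rw [← D.projP_of_mem hy, ← projP_pos_f]
  exact D.projP_mem _

theorem pos_f_mem_r {y : 𝔤} (hy : y ∈ D.r) : T.pos T.f y ∈ D.r := by
  rw [← D.projR_of_mem hy, ← projR_pos_f]
  exact D.projR_mem _

theorem neg_f_mem_p {y : 𝔤} (hy : y ∈ D.p) : T.neg T.f y ∈ D.p := by
  refine D.mem_p_iff.2 fun x hx => ?_
  rw [form_comm, form_neg, form_comm]
  exact hy _ (T.pos_f_mem_r hx)

/-- The Borel subalgebra `𝔟 = 𝔥 + 𝔫`, as the space of elements without negative components. -/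
def borel : Submodule ℂ 𝔤 := LinearMap.ker (T.neg T.f)

theorem mem_borel_iff {y : 𝔤} : y ∈ T.borel ↔ T.neg T.f y = 0 := LinearMap.mem_ker

theorem eq_of_mem_borel {y : 𝔤} (hy : y ∈ T.borel) : T.zer T.f y + T.pos T.f y = y := by
  have h := T.pos_add_zer_add_neg T.f y
  rwa [T.mem_borel_iff.1 hy, add_zero, add_comm] at h

theorem mem_borel_of_mem_n {y : 𝔤} (hy : y ∈ T.n) : y ∈ T.borel := T.neg_eq_zero hy

theorem mem_borel_of_mem_h {y : 𝔤} (hy : y ∈ T.h) : y ∈ T.borel := T.neg_of_mem_h hy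

theorem lie_mem_n_of_mem_h {x y : 𝔤} (hx : x ∈ T.h) (hy : y ∈ T.n) : ⁅x, y⁆ ∈ T.n :=
  T.n.lie_mem (x := ⟨x, hx⟩) hy

theorem lie_mem_n {x y : 𝔤} (hx : x ∈ T.borel) (hy : y ∈ T.borel) : ⁅x, y⁆ ∈ T.n := by
  rw [← T.eq_of_mem_borel hx, ← T.eq_of_mem_borel hy, add_lie, lie_add, lie_add,
    T.lie_eq_zero_of_mem_h (T.zer_f_mem x) (T.zer_f_mem y), zero_add]
  have h : ⁅T.pos T.f x, T.zer T.f y⁆ ∈ T.n := by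
    rw [← lie_skew]
    exact T.n.toSubmodule.neg_mem (T.lie_mem_n_of_mem_h (T.zer_f_mem y) (T.pos_mem _ x))
  exact T.n.toSubmodule.add_mem (T.lie_mem_n_of_mem_h (T.zer_f_mem x) (T.pos_mem _ y))
    (T.n.toSubmodule.add_mem h (T.lie_mem_posPart (T.pos_mem _ x) (T.pos_mem _ y)))

theorem form_n_borel {x y : 𝔤} (hx : x ∈ T.n) (hy : y ∈ T.borel) : D.form x y = 0 := by
  rw [← T.pos_eq_self hx, form_comm, ← form_neg, T.mem_borel_iff.1 hy, map_zero,
    LinearMap.zero_apply]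

/-- The polarization of `𝔭` given by `𝔫_𝔭` and `𝔟 ∩ 𝔭 = 𝔥_𝔭 + 𝔫_𝔭`. -/
def polarization : D.Polarization where
  N := T.np
  B := T.borel.comap D.p.toSubmodule.subtype
  s := (T.neg T.f).restrict (p := D.p.toSubmodule) (q := D.p.toSubmodule)
    fun _ hy => T.neg_f_mem_p hy
  s' := (T.pos T.f).restrict (p := D.p.toSubmodule) (q := D.p.toSubmodule)
    fun _ hy => T.pos_f_mem_p hy
  adjoint x y := T.form_neg T.f x y
  s'_mem y := T.pos_mem T.f y
  sub_mem x := by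
    change T.neg T.f ((x : 𝔤) - T.neg T.f x) = 0
    refine T.ext_comp fun α => ?_
    rw [comp_neg, map_sub, comp_neg, map_zero]
    split_ifs
    · exact sub_self _
    · rfl
  le _ hy := T.mem_borel_of_mem_n hy
  ortho _ hn _ hy := T.form_n_borel hn hy
  tri_eq_zero _ hx _ hy _ hz := T.form_n_borel (T.lie_mem_n hx hy) hz

/-! ### Traces -/

/-- The trace on a space `W` of an operator which extends, along an injection `i` with a left
inverse `π`, to an operator `F` of the ambient space. -/
theorem trace_of_retract {W : Type*} [AddCommGroup W] [Module ℂ W] [FiniteDimensional ℂ W]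
    (i : W →ₗ[ℂ] 𝔤) (π : 𝔤 →ₗ[ℂ] W) (hπ : π ∘ₗ i = LinearMap.id) (S : Module.End ℂ W)
    (F : Module.End ℂ 𝔤) (hF : i ∘ₗ S = F ∘ₗ i) :
    LinearMap.trace ℂ W S = LinearMap.trace ℂ 𝔤 (F ∘ₗ i ∘ₗ π) := by
  rw [← LinearMap.comp_assoc, ← hF, LinearMap.comp_assoc, LinearMap.trace_comp_comm' (S ∘ₗ π) i,
    LinearMap.comp_assoc, hπ, LinearMap.comp_id]

/-- `ad x`, as a linear endomorphism. -/
abbrev adE (x : 𝔤) : Module.End ℂ 𝔤 := LieAlgebra.ad ℂ 𝔤 x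

theorem trace_comp_root (α : T.Wt) (hα : α.IsNonZero) : LinearMap.trace ℂ 𝔤 (T.comp α) = 1 := by
  have h : LinearMap.IsProj (T.rootSub α) (T.comp α) :=
    ⟨T.comp_mem α, fun z hz => by rw [T.comp_of_mem hz, if_pos rfl]⟩
  have h1 : Module.finrank ℂ (T.rootSub α) = 1 :=
    LieAlgebra.IsKilling.finrank_rootSpace_eq_one α hα
  rw [h.trace, h1, Nat.cast_one]

theorem isNonZero_of_pos {s : T.h} {α : T.Wt} (h : 0 < (α s).re) : α.IsNonZero := by
  intro h0
  rw [show (α : T.h → ℂ) = 0 from h0] at h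
  simp at h

theorem trace_ad_pos (x : T.h) :
    LinearMap.trace ℂ 𝔤 (adE (x : 𝔤) ∘ₗ T.pos T.f) = 2 * T.rho x := by
  classical
  have h1 : adE (x : 𝔤) ∘ₗ T.pos T.f =
      ∑ α ∈ T.h.root with 0 < (α T.f).re, α x • T.comp α := by
    refine LinearMap.ext fun z => T.ext_comp fun β => ?_
    rw [LinearMap.comp_apply, LieAlgebra.ad_apply, comp_lie, comp_pos, LinearMap.sum_apply, map_sum]
    simp only [LinearMap.smul_apply, map_smul]
    split_ifs with h
    · rw [Finset.sum_eq_single β, comp_self]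
      · intro α _ hα
        rw [T.comp_ne hα.symm, smul_zero]
      · intro hβ
        refine (hβ ?_).elim
        rw [Finset.mem_filter]
        exact ⟨by simpa using T.isNonZero_of_pos h, h⟩
    · rw [smul_zero, Finset.sum_eq_zero]
      intro α hα
      rw [T.comp_ne, smul_zero]
      rintro rfl
      exact h (Finset.mem_filter.1 hα).2
  rw [h1, map_sum, rho, LinearMap.smul_apply, LinearMap.sum_apply, smul_eq_mul]
  have h2 : ∀ α ∈ T.h.root.filter (fun α : T.Wt => 0 < (α T.f).re),
      LinearMap.trace ℂ 𝔤 (α x • T.comp α) = LieModule.Weight.toLinear ℂ T.h 𝔤 α x := by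
    intro α hα
    rw [map_smul, T.trace_comp_root α (T.isNonZero_of_pos (Finset.mem_filter.1 hα).2), smul_eq_mul,
      mul_one]
    rfl
  rw [Finset.sum_congr rfl h2]
  ring_nf

/-- If `ad s` multiplies `z` by a nonzero number and commutes with `Q`, then `ad z ∘ Q` is a
multiple of a commutator, and has trace zero. -/
theorem trace_ad_comp_eq_zero {s z : 𝔤} {c : ℂ} (hc : c ≠ 0) (hz : ⁅s, z⁆ = c • z)
    {Q : Module.End ℂ 𝔤} (hQ : ∀ y, Q ⁅s, y⁆ = ⁅s, Q y⁆) :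
    LinearMap.trace ℂ 𝔤 (adE z ∘ₗ Q) = 0 := by
  have h1 : c • (adE z ∘ₗ Q) = adE s ∘ₗ (adE z ∘ₗ Q) - (adE z ∘ₗ Q) ∘ₗ adE s := by
    refine LinearMap.ext fun y => ?_
    simp only [LinearMap.smul_apply, LinearMap.comp_apply, LinearMap.sub_apply,
      LieAlgebra.ad_apply, hQ]
    rw [← smul_lie, ← hz, lie_lie]
  have h2 := congrArg (LinearMap.trace ℂ 𝔤) h1
  rw [map_smul, map_sub, LinearMap.trace_comp_comm' (adE s) (adE z ∘ₗ Q), sub_self] at h2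
  exact (smul_eq_zero.1 h2).resolve_left hc

/-- The trace of `ad z ∘ Q` vanishes if `z` lies in `posPart s` and `Q` commutes with `ad s'`,
where `s'` has eigenvalues with the same real parts as `s`. -/
theorem trace_ad_posPart {s s' : T.h} (hs : ∀ α : T.Wt, (α s').re = (α s).re) {z : 𝔤}
    (hz : z ∈ T.posPart s) {Q : Module.End ℂ 𝔤}
    (hQ : ∀ y, Q ⁅(s' : 𝔤), y⁆ = ⁅(s' : 𝔤), Q y⁆) : LinearMap.trace ℂ 𝔤 (adE z ∘ₗ Q) = 0 := by
  have h1 : adE z ∘ₗ Q = ∑ α, adE (T.comp α z) ∘ₗ Q := by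
    refine LinearMap.ext fun y => ?_
    conv_lhs => rw [← T.sum_comp z]
    simp
  rw [h1, map_sum]
  refine Finset.sum_eq_zero fun α _ => ?_
  by_cases hα : 0 < (α s).re
  · refine trace_ad_comp_eq_zero (c := α s') ?_ (T.lie_comp s' α z) hQ
    intro h0
    rw [← hs, h0] at hα
    simp at hα
  · rw [T.mem_posPart_iff.1 hz α hα, adE, map_zero, LinearMap.zero_comp, map_zero]

theorem tau_eq_trace (y : 𝔤) :
    T.polarization.tau y = LinearMap.trace ℂ 𝔤 (adE y ∘ₗ T.pos T.f ∘ₗ D.projP) := by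
  have h : adE y ∘ₗ T.pos T.f ∘ₗ D.projP =
      ∑ i, (D.form (D.b i : 𝔤)).smulRight ⁅y, T.pos T.f (D.d i)⁆ := by
    refine LinearMap.ext fun z => ?_
    simp [projP_apply]
  rw [h, map_sum]
  simp only [LinearMap.trace_smulRight]
  rfl

theorem rhoR_apply (x : T.hr) : T.rhoR x = (1 / 2 : ℂ) *
    LinearMap.trace ℂ 𝔤 (adE ((x : D.r) : 𝔤) ∘ₗ T.pos T.f ∘ₗ D.projR) := by
  rw [rhoR, LinearMap.smul_apply, smul_eq_mul]
  congr 1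
  let i : T.nr →ₗ[ℂ] 𝔤 := D.r.toSubmodule.subtype ∘ₗ T.nr.toSubmodule.subtype
  let π : 𝔤 →ₗ[ℂ] T.nr := LinearMap.codRestrict T.nr.toSubmodule
    (LinearMap.codRestrict D.r.toSubmodule (T.pos T.f ∘ₗ D.projR)
      fun z => T.pos_f_mem_r (D.projR_mem z)) fun z => T.pos_mem T.f (D.projR z)
  refine trace_of_retract i π (LinearMap.ext fun z => ?_) _ (adE ((x : D.r) : 𝔤))
    (LinearMap.ext fun z => rfl)
  refine Subtype.ext (Subtype.ext ?_)
  change T.pos T.f (D.projR ((z : D.r) : 𝔤)) = ((z : D.r) : 𝔤)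
  rw [D.projR_of_mem (z : D.r).2]
  exact T.pos_eq_self z.2

theorem rhoP_apply (x : T.hr) : T.rhoP x = (1 / 2 : ℂ) *
    LinearMap.trace ℂ 𝔤 (adE ((x : D.r) : 𝔤) ∘ₗ T.pos T.fr ∘ₗ D.projP) := by
  rw [rhoP, LinearMap.smul_apply, smul_eq_mul]
  congr 1
  let i : T.pPlus →ₗ[ℂ] 𝔤 := D.p.toSubmodule.subtype ∘ₗ T.pPlus.toSubmodule.subtype
  let π : 𝔤 →ₗ[ℂ] T.pPlus := LinearMap.codRestrict T.pPlus.toSubmodule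
    (LinearMap.codRestrict D.p.toSubmodule (T.pos T.fr ∘ₗ D.projP)
      fun z => by
        rw [LinearMap.comp_apply, ← projP_pos_fr]
        exact D.projP_mem _) fun z => T.pos_mem T.fr (D.projP z)
  refine trace_of_retract i π (LinearMap.ext fun z => ?_) _ (adE ((x : D.r) : 𝔤))
    (LinearMap.ext fun z => rfl)
  refine Subtype.ext (Subtype.ext ?_)
  change T.pos T.fr (D.projP ((z : D.p) : 𝔤)) = ((z : D.p) : 𝔤)
  rw [D.projP_of_mem (z : D.p).2]
  exact T.pos_eq_self z.2

/-- Since `𝔥_𝔯` centralizes the part of `𝔫` outside the nilradical of `𝔮`, the spin action of `𝔥_𝔯`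
has the weight `ρ_𝔭`. -/
theorem tau_hr (x : T.hr) : T.polarization.tau ((x : D.r) : 𝔤) = 2 * T.rhoP x := by
  rw [tau_eq_trace, rhoP_apply, ← mul_assoc]
  have h : adE ((x : D.r) : 𝔤) ∘ₗ T.pos T.f ∘ₗ D.projP =
      adE ((x : D.r) : 𝔤) ∘ₗ T.pos T.fr ∘ₗ D.projP := by
    refine LinearMap.ext fun z => ?_
    rw [LinearMap.comp_apply, LinearMap.comp_apply, pos_f_eq, map_add, LieAlgebra.ad_apply,
      LieAlgebra.ad_apply, T.lie_zer_fr (show ((x : D.r) : 𝔤) ∈ T.h from x.2) (x : D.r).2, add_zero]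
    rfl
  rw [h]
  norm_num

theorem rhoP_add_rhoR : T.rhoP + T.rhoR = T.restrictHr T.rho := by
  refine LinearMap.ext fun x => ?_
  have h1 := T.tau_hr x
  have h2 := T.rhoR_apply x
  have h3 := T.trace_ad_pos (T.hrIncl x)
  have h4 : adE ((T.hrIncl x : T.h) : 𝔤) ∘ₗ T.pos T.f =
      adE ((x : D.r) : 𝔤) ∘ₗ T.pos T.f ∘ₗ D.projP +
        adE ((x : D.r) : 𝔤) ∘ₗ T.pos T.f ∘ₗ D.projR := by
    refine LinearMap.ext fun z => ?_
    simp only [LinearMap.add_apply, LinearMap.comp_apply]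
    rw [← map_add, ← map_add, projR_apply, add_sub_cancel]
    rfl
  rw [h4, map_add, ← tau_eq_trace] at h3
  rw [LinearMap.add_apply]
  change _ = T.rho (T.hrIncl x)
  linear_combination h2 - (1 / 2 : ℂ) * h1 + (1 / 2 : ℂ) * h3

/-- For `y ∈ 𝔟 ∩ 𝔭`, the number `τ(y)` is twice the value of `ρ` at the component of `y` in `𝔥`. -/
theorem tau_borel {y : 𝔤} (hy : y ∈ T.borel) (hp : y ∈ D.p) :
    T.polarization.tau y = 2 * T.rho ⟨T.zer T.f y, T.zer_f_mem y⟩ := by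
  rw [tau_eq_trace, ← trace_ad_pos]
  -- `ad y` maps `𝔯` to `𝔭`, so that only `𝔫_𝔭` contributes to its trace on `𝔫`.
  have h1 : LinearMap.trace ℂ 𝔤 (adE y ∘ₗ T.pos T.f ∘ₗ D.projR) = 0 := by
    have h : adE y ∘ₗ T.pos T.f ∘ₗ D.projR = (D.projP ∘ₗ adE y) ∘ₗ (T.pos T.f ∘ₗ D.projR) := by
      refine LinearMap.ext fun z => ?_
      exact (D.projP_of_mem (D.lie_mem_p_of_mem hp (T.pos_f_mem_r (D.projR_mem z)))).symm
    have h' : D.projR ∘ₗ D.projP = 0 :=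
      LinearMap.ext fun z => D.projR_of_mem_p (D.projP_mem z)
    rw [h, LinearMap.trace_comp_comm', LinearMap.comp_assoc, ← LinearMap.comp_assoc _ D.projP, h',
      LinearMap.zero_comp, LinearMap.comp_zero, map_zero]
  have h2 : LinearMap.trace ℂ 𝔤 (adE (T.pos T.f y) ∘ₗ T.pos T.f) = 0 :=
    T.trace_ad_posPart (s' := T.f) (fun _ => rfl) (T.pos_mem T.f y) (T.pos_lie T.f T.f)
  have h3 : adE (T.zer T.f y) ∘ₗ T.pos T.f = adE y ∘ₗ T.pos T.f ∘ₗ D.projP +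
      adE y ∘ₗ T.pos T.f ∘ₗ D.projR - adE (T.pos T.f y) ∘ₗ T.pos T.f := by
    refine LinearMap.ext fun z => ?_
    simp only [LinearMap.add_apply, LinearMap.sub_apply, LinearMap.comp_apply]
    rw [← map_add, ← map_add, projR_apply, add_sub_cancel, ← LinearMap.sub_apply, ← map_sub,
      sub_eq_of_eq_add (T.eq_of_mem_borel hy).symm]
  change _ = LinearMap.trace ℂ 𝔤 (adE (T.zer T.f y) ∘ₗ T.pos T.f)
  rw [h3, map_sub, map_add, h1, h2, add_zero, sub_zero]

theorem tau_nr {x : 𝔤} (hr : x ∈ D.r) (hx : x ∈ T.n) : T.polarization.tau x = 0 := by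
  rw [tau_eq_trace]
  refine T.trace_ad_posPart (s := T.fr) T.t₀_re (z := x) ?_ fun y => ?_
  · rw [← T.pos_eq_self hx, T.pos_f_of_mem_r hr]
    exact T.pos_mem _ x
  · rw [LinearMap.comp_apply, LinearMap.comp_apply, D.projP_lie T.t₀_mem, pos_lie]

/-! ### The subspace `C(𝔥_𝔭) u` of the spin module -/

/-- If `x` anticommutes with the members of a list containing it, and `x² = 0`, then `x` kills the
product of the list. -/
theorem mul_list_prod_eq_zero {A : Type*} [Ring A] {x : A} (hx : x * x = 0) :
    ∀ l : List A, (∀ y ∈ l, x * y = -(y * x)) → x ∈ l → x * l.prod = 0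
  | [], _, h => absurd h List.not_mem_nil
  | y :: l, hl, h => by
    rw [List.prod_cons]
    by_cases hxy : x = y
    · rw [← hxy, ← mul_assoc, hx, zero_mul]
    · rw [← mul_assoc, hl y List.mem_cons_self, neg_mul, mul_assoc,
        mul_list_prod_eq_zero hx l (fun z hz => hl z (List.mem_cons_of_mem y hz))
          ((List.mem_cons.1 h).resolve_left hxy), mul_zero, neg_zero]

theorem γ_anticomm_np {n : D.p} (hn : n ∈ T.np) {y : D.p} (hy : (y : 𝔤) ∈ T.borel) :
    D.γ n * D.γ y = -(D.γ y * D.γ n) := by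
  have h : D.formP n y = 0 := T.form_n_borel hn hy
  rw [γ_anticomm, h, mul_zero, map_zero, zero_sub]

theorem γ_mul_self_np {n : D.p} (hn : n ∈ T.np) : D.γ n * D.γ n = 0 := by
  have h : D.formP n n = 0 := T.form_n_borel hn (T.mem_borel_of_mem_n hn)
  rw [CliffordAlgebra.ι_sq_scalar]
  change algebraMap ℂ D.Cl (D.formP n n) = 0
  rw [h, map_zero]

variable {m : ℕ} (e : Module.Basis (Fin m) ℂ T.np)

theorem γ_mul_u {n : D.p} (hn : n ∈ T.np) : D.γ n * T.u e = 0 := by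
  have h : ∀ i, D.γ (e i : D.p) * T.u e = 0 := fun i => by
    refine mul_list_prod_eq_zero (T.γ_mul_self_np (e i).2) _ (fun y hy => ?_) ?_
    · obtain ⟨j, rfl⟩ := (List.mem_ofFn' _ _).1 hy
      exact T.γ_anticomm_np (e i).2 (T.mem_borel_of_mem_n (e j).2)
    · exact (List.mem_ofFn' _ _).2 ⟨i, rfl⟩
  have h1 : n = ∑ i, e.repr ⟨n, hn⟩ i • (e i : D.p) := by
    have h := congrArg T.np.subtype (e.sum_repr ⟨n, hn⟩)
    rw [map_sum] at h
    exact h.symm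
  rw [h1, map_sum, Finset.sum_mul]
  refine Finset.sum_eq_zero fun i _ => ?_
  rw [map_smul, smul_mul_assoc, h, smul_zero]

/-- `𝔫_𝔭` can be moved to the right through `C(𝔥_𝔭)`. -/
theorem exists_γ_mul_clHp {a : D.Cl} (ha : a ∈ T.clHp) :
    ∃ a', ∀ n ∈ T.np, D.γ n * a = a' * D.γ n := by
  induction ha using Algebra.adjoin_induction with
  | mem x hx =>
    obtain ⟨y, hy, rfl⟩ := hx
    exact ⟨-D.γ y, fun n hn => by
      rw [T.γ_anticomm_np hn (T.mem_borel_of_mem_h hy), neg_mul]⟩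
  | algebraMap r => exact ⟨algebraMap ℂ _ r, fun n _ => (Algebra.commutes r _).symm⟩
  | add a b _ _ ha hb =>
    obtain ⟨a', ha'⟩ := ha
    obtain ⟨b', hb'⟩ := hb
    exact ⟨a' + b', fun n hn => by rw [mul_add, add_mul, ha' n hn, hb' n hn]⟩
  | mul a b _ _ ha hb =>
    obtain ⟨a', ha'⟩ := ha
    obtain ⟨b', hb'⟩ := hb
    exact ⟨a' * b', fun n hn => by rw [← mul_assoc, ha' n hn, mul_assoc, hb' n hn, mul_assoc]⟩

theorem γ_mul_clHp_mul_u {a : D.Cl} (ha : a ∈ T.clHp) {n : D.p} (hn : n ∈ T.np) :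
    D.γ n * (a * T.u e) = 0 := by
  obtain ⟨a', ha'⟩ := T.exists_γ_mul_clHp ha
  rw [← mul_assoc, ha' n hn, mul_assoc, T.γ_mul_u e hn, mul_zero]

theorem nu_hr_mul {w : D.Cl} (hw : ∀ n ∈ T.np, D.γ n * w = 0) (x : T.hr) :
    D.nu x * w = T.rhoP x • w := by
  have h := T.polarization.nu_mul hw x fun y hy =>
    T.lie_mem_n (T.mem_borel_of_mem_h (show ((x : D.r) : 𝔤) ∈ T.h from x.2)) hy
  rw [h, T.tau_hr]
  congr 1
  ring

theorem nu_nr_mul {w : D.Cl} (hw : ∀ n ∈ T.np, D.γ n * w = 0) {x : D.r} (hx : (x : 𝔤) ∈ T.n) :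
    D.nu x * w = 0 := by
  have h := T.polarization.nu_mul hw x fun y hy => T.lie_mem_n (T.mem_borel_of_mem_n hx) hy
  rw [h, T.tau_nr x.2 hx, mul_zero, zero_smul]

/-! ### The highest weight vector -/

section HighestWeightVector

variable (lam : Module.Dual ℂ T.h)

theorem ι_smul_hwVector_of_mem_n {x : 𝔤} (hx : x ∈ T.n) :
    UniversalEnvelopingAlgebra.ι ℂ x • hwVector T.h T.n.toSubmodule lam = 0 := by
  have h : UniversalEnvelopingAlgebra.ι ℂ x ∈ vermaIdeal T.h T.n.toSubmodule lam :=
    Submodule.mem_sup_left (Submodule.subset_span ⟨x, hx, rfl⟩)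
  rw [hwVector, ← Submodule.Quotient.mk_smul, ← Submodule.Quotient.mk_smul, smul_eq_mul, mul_one,
    (Submodule.Quotient.mk_eq_zero _).2 h]
  rfl

theorem ι_smul_hwVector_of_mem_h (x : T.h) :
    UniversalEnvelopingAlgebra.ι ℂ (x : 𝔤) • hwVector T.h T.n.toSubmodule lam =
      lam x • hwVector T.h T.n.toSubmodule lam := by
  have h : UniversalEnvelopingAlgebra.ι ℂ (x : 𝔤) -
      algebraMap ℂ (UniversalEnvelopingAlgebra ℂ 𝔤) (lam x) ∈
        vermaIdeal T.h T.n.toSubmodule lam :=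
    Submodule.mem_sup_right (Submodule.subset_span ⟨x, rfl⟩)
  rw [← algebraMap_smul (UniversalEnvelopingAlgebra ℂ 𝔤) (lam x), ← sub_eq_zero, ← sub_smul,
    hwVector, ← Submodule.Quotient.mk_smul, ← Submodule.Quotient.mk_smul, smul_eq_mul, mul_one,
    (Submodule.Quotient.mk_eq_zero _).2 h]
  rfl

/-- If `λ + ρ` vanishes on `𝔥_𝔭`, then `𝔟 ∩ 𝔭` acts on the highest weight vector by `-τ/2`. -/
theorem ι_smul_hwVector_of_mem_borel (hlam : ∀ x : T.h, (x : 𝔤) ∈ D.p → (lam + T.rho) x = 0)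
    {y : 𝔤} (hy : y ∈ T.borel) (hp : y ∈ D.p) :
    UniversalEnvelopingAlgebra.ι ℂ y • hwVector T.h T.n.toSubmodule lam =
      (-(1 / 2 : ℂ) * T.polarization.tau y) • hwVector T.h T.n.toSubmodule lam := by
  have hz : T.zer T.f y ∈ D.p := by
    have h : T.zer T.f y = y - T.pos T.f y := (sub_eq_of_eq_add (T.eq_of_mem_borel hy).symm).symm
    rw [h]
    exact D.p.toSubmodule.sub_mem hp (T.pos_f_mem_p hp)
  have h1 := hlam ⟨T.zer T.f y, T.zer_f_mem y⟩ hz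
  rw [LinearMap.add_apply] at h1
  have h2 := T.ι_smul_hwVector_of_mem_h lam ⟨T.zer T.f y, T.zer_f_mem y⟩
  conv_lhs => rw [← T.eq_of_mem_borel hy, map_add, add_smul,
    T.ι_smul_hwVector_of_mem_n lam (T.pos_mem T.f y), add_zero]
  refine h2.trans ?_
  rw [T.tau_borel hy hp]
  congr 1
  linear_combination h1

end HighestWeightVector

/-! ### Harish-Chandra projections of `𝔤` and `𝔯` -/

theorem exists_congruentModN_g (z : Subalgebra.center ℂ (UniversalEnvelopingAlgebra ℂ 𝔤)) :
    ∃ s, CongruentModN T.h T.n.toSubmodule (z : UniversalEnvelopingAlgebra ℂ 𝔤) s := by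
  refine exists_congruentModN T.h T.n.toSubmodule (T.f : 𝔤) T.f.2
    (fun t ht => T.lie_eq_zero_of_mem_h T.f.2 ht) (fun t ht x hx => T.lie_mem_n_of_mem_h ht hx)
    (eq_top_iff.2 fun z _ => ?_) z
  have h : T.neg T.f z ∈ negEigen (LieAlgebra.ad ℂ 𝔤 (T.f : 𝔤)) := by
    rw [← T.sum_comp (T.neg T.f z)]
    refine Submodule.sum_mem _ fun α _ => ?_
    rw [comp_neg]
    split_ifs with hα
    · exact mem_negEigen hα (T.lie_comp T.f α z)
    · exact Submodule.zero_mem _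
  rw [← T.pos_add_zer_add_neg T.f z, add_comm, add_comm (T.pos T.f z), ← add_assoc]
  exact Submodule.add_mem_sup (Submodule.add_mem_sup h (T.zer_f_mem z)) (T.pos_mem T.f z)

theorem exists_congruentModN_r (z : Subalgebra.center ℂ (UniversalEnvelopingAlgebra ℂ D.r)) :
    ∃ s, CongruentModN T.hr T.nr.toSubmodule (z : UniversalEnvelopingAlgebra ℂ D.r) s := by
  refine exists_congruentModN T.hr T.nr.toSubmodule (⟨T.t₀, T.t₀_mem⟩ : D.r) T.t₀.2
    (fun t ht => Subtype.ext (T.lie_eq_zero_of_mem_h T.t₀.2 ht))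
    (fun t ht x hx => T.nr.lie_mem (x := ⟨t, ht⟩) hx) (eq_top_iff.2 fun y _ => ?_) z
  let R : 𝔤 →ₗ[ℂ] D.r := LinearMap.codRestrict D.r.toSubmodule D.projR D.projR_mem
  have hR : y = R (T.neg T.fr y) + R (T.zer T.fr y) + R (T.pos T.fr y) := by
    rw [← map_add, ← map_add, add_comm (T.neg T.fr (y : 𝔤)), add_comm, ← add_assoc,
      pos_add_zer_add_neg]
    exact Subtype.ext (D.projR_of_mem y.2).symm
  -- The projections to `𝔯` of root vectors are eigenvectors of `ad t₀`.
  have h : R (T.neg T.fr y) ∈ negEigen (LieAlgebra.ad ℂ D.r (⟨T.t₀, T.t₀_mem⟩ : D.r)) := by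
    rw [← T.sum_comp (T.neg T.fr y), map_sum]
    refine Submodule.sum_mem _ fun α _ => ?_
    rw [comp_neg]
    split_ifs with hα
    · refine mem_negEigen (c := α T.t₀) (by rwa [T.t₀_re]) (Subtype.ext ?_)
      change ⁅(T.t₀ : 𝔤), D.projR (T.comp α y)⁆ = α T.t₀ • D.projR (T.comp α y)
      rw [← D.projR_lie T.t₀_mem, T.lie_comp, map_smul]
    · rw [map_zero]
      exact Submodule.zero_mem _
  have h0 : R (T.zer T.fr y) ∈ T.hr.toSubmodule := by
    change D.projR (T.zer T.fr y) ∈ T.h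
    rw [projR_zer_fr, D.projR_of_mem y.2]
    exact T.zer_fr_mem_h y.2
  have h1 : R (T.pos T.fr y) ∈ T.nr.toSubmodule := by
    change D.projR (T.pos T.fr y) ∈ T.n
    rw [projR_pos_fr]
    exact T.posPart_fr_le (T.pos_mem _ _)
  rw [hR]
  exact Submodule.add_mem_sup (Submodule.add_mem_sup h h0) h1

/-! ### The cocycles -/

section Cocycles

variable (lam : Module.Dual ℂ T.h)

theorem diracOp_cocycle (hlam : ∀ x : T.h, (x : 𝔤) ∈ D.p → (lam + T.rho) x = 0) {a : D.Cl}
    (ha : a ∈ T.clHp) : D.diracOp (T.V lam) (T.L e)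
      (hwVector T.h T.n.toSubmodule lam ⊗ₜ[ℂ] (a • T.uL e)) = 0 :=
  T.polarization.diracOp_tmul (fun _ hn => T.γ_mul_clHp_mul_u e ha hn)
    fun y hy => T.ι_smul_hwVector_of_mem_borel lam hlam hy y.2

theorem center_smul_cocycle (p : Subalgebra.center ℂ (UniversalEnvelopingAlgebra ℂ 𝔤))
    (l : T.L e) : D.xi (T.V lam) (T.L e)
      ((p : UniversalEnvelopingAlgebra ℂ 𝔤) ⊗ₜ[ℂ] 1)
        (hwVector T.h T.n.toSubmodule lam ⊗ₜ[ℂ] l) =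
      evalSym (T.AG p) (lam + T.rho) • (hwVector T.h T.n.toSubmodule lam ⊗ₜ[ℂ] l) := by
  rw [AG, evalSym_harishChandra T.h T.n.toSubmodule T.rho lam _ (add_sub_cancel_right _ _)]
  refine center_smul_highestWeight T.h T.n.toSubmodule
    ((D.xi (T.V lam) (T.L e)).comp Algebra.TensorProduct.includeLeft) _ lam (fun x hx => ?_)
    (fun t => ?_) p (T.exists_congruentModN_g p)
  · rw [AlgHom.comp_apply, Algebra.TensorProduct.includeLeft_apply, xi_tmul_tmul,
      T.ι_smul_hwVector_of_mem_n lam hx, TensorProduct.zero_tmul]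
  · rw [AlgHom.comp_apply, Algebra.TensorProduct.includeLeft_apply, xi_tmul_tmul,
      T.ι_smul_hwVector_of_mem_h lam t, one_smul, TensorProduct.smul_tmul']

theorem zeta_smul_cocycle (q : Subalgebra.center ℂ (UniversalEnvelopingAlgebra ℂ D.r)) {a : D.Cl}
    (ha : a ∈ T.clHp) : D.xi (T.V lam) (T.L e) (D.zeta q)
        (hwVector T.h T.n.toSubmodule lam ⊗ₜ[ℂ] (a • T.uL e)) =
      evalSym (T.AR q) (T.restrictHr (lam + T.rho)) •
        (hwVector T.h T.n.toSubmodule lam ⊗ₜ[ℂ] (a • T.uL e)) := by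
  have hρ : T.restrictHr (lam + T.rho) - T.rhoR = T.restrictHr lam + T.rhoP := by
    have h := T.rhoP_add_rhoR
    have h' : T.restrictHr (lam + T.rho) = T.restrictHr lam + T.restrictHr T.rho := rfl
    rw [h', ← h]
    abel
  have hw : ∀ n ∈ T.np, D.γ n * (a * T.u e) = 0 := fun n hn => T.γ_mul_clHp_mul_u e ha hn
  rw [AR, evalSym_harishChandra T.hr T.nr.toSubmodule T.rhoR _ _ hρ]
  refine center_smul_highestWeight T.hr T.nr.toSubmodule
    ((D.xi (T.V lam) (T.L e)).comp D.zeta) _ _ (fun x hx => ?_)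
    (fun t => ?_) q (T.exists_congruentModN_r q)
  · have h : D.nu x • (a • T.uL e) = 0 := Subtype.ext (T.nu_nr_mul hw hx)
    have h' := T.ι_smul_hwVector_of_mem_n lam (x := (x : 𝔤)) hx
    rw [AlgHom.comp_apply, xi_zeta_ι, h', TensorProduct.zero_tmul, h,
      TensorProduct.tmul_zero, add_zero]
  · have h : D.nu t • (a • T.uL e) = T.rhoP t • (a • T.uL e) := Subtype.ext (T.nu_hr_mul hw t)
    have h' := T.ι_smul_hwVector_of_mem_h lam (T.hrIncl t)
    generalize a • T.uL e = l at h ⊢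
    rw [AlgHom.comp_apply, xi_zeta_ι, h, LinearMap.add_apply, add_smul]
    exact congrArg₂ (· + ·) (congrArg (· ⊗ₜ[ℂ] l) h') (TensorProduct.tmul_smul (R := ℂ)
      (T.rhoP t) (hwVector T.h T.n.toSubmodule lam) l)

theorem cocycles_le_ker (hlam : ∀ x : T.h, (x : 𝔤) ∈ D.p → (lam + T.rho) x = 0) :
    T.cocycles e lam ≤ LinearMap.ker (D.diracOp (T.V lam) (T.L e)) := by
  refine Submodule.span_le.2 ?_
  rintro _ ⟨a, ha, rfl⟩
  exact T.diracOp_cocycle e lam hlam ha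

end Cocycles

end CartanData

end QuadraticPair

end CubicDirac

end

theorem theorem4p1 {𝔤 : Type*} [LieRing 𝔤] [LieAlgebra ℂ 𝔤] [FiniteDimensional ℂ 𝔤]
    [LieAlgebra.IsSemisimple ℂ 𝔤] (D : CubicDirac.QuadraticPair 𝔤) (T : D.CartanData)
    {m : ℕ} (e : Module.Basis (Fin m) ℂ T.np) (lam : Module.Dual ℂ T.h)
    (hlam : ∀ x : T.h, (x : 𝔤) ∈ D.p → (lam + T.rho) x = 0) :
    -- the elements of `ℂ v_λ ⊗ C(𝔥_𝔭) u` are Dirac cocycles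
    T.cocycles e lam ≤ LinearMap.ker (D.diracOp (T.V lam) (T.L e)) ∧
    -- the action of `Z(𝔤)`
    (∀ p : Subalgebra.center ℂ (UniversalEnvelopingAlgebra ℂ 𝔤), ∀ w ∈ T.E e lam,
      D.centerAction (T.V lam) (T.L e) p w = CubicDirac.evalSym (T.AG p) (lam + T.rho) • w) ∧
    -- the action of `Z(𝔯)` through `ζ`
    (∀ q : Subalgebra.center ℂ (UniversalEnvelopingAlgebra ℂ D.r), ∀ w ∈ T.E e lam,
      D.zetaAction (T.V lam) (T.L e) q w =
        CubicDirac.evalSym (T.AR q) (T.restrictHr (lam + T.rho)) • w) ∧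
    -- the two half sums on `𝔥_𝔯`
    T.rhoP + T.rhoR = T.restrictHr T.rho := by
  refine ⟨T.cocycles_le_ker e lam hlam, fun p => ?_, fun q => ?_, T.rhoP_add_rhoR⟩
  · refine CubicDirac.cohomologyAction_eq_smul _ _ _ _ ?_
    rintro _ ⟨a, -, rfl⟩
    exact T.center_smul_cocycle e lam p _
  · refine CubicDirac.cohomologyAction_eq_smul _ _ _ _ ?_
    rintro _ ⟨a, ha, rfl⟩
    exact T.zeta_smul_cocycle e lam q ha
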